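/- Let $q\ge 2$ be an integer and let $T=\mathbb T_q$ be the homogeneous tree of degree $q+1$ with a distinguished end $\omega$. Each vertex has one predecessor (its neighbour towards $\omega$) and $q$ successors; let $\mathfrak h:T\to\mathbb Z$ be the Busemann function (horocycle index) with respect to $\omega$, which increases by one from a vertex to each of its successors and vanishes at a chosen origin. The Diestel–Leader graph $\mathrm{DL}(q,q,q)$ has vertex set $\{x=(x_1,x_2,x_3)\in T^3:\mathfrak h(x_1)+\mathfrak h(x_2)+\mathfrak h(x_3)=0\}$, and $x\sim y$ if and only if there are $i\ne j$ such that $x_i\sim y_i$ and $x_j\sim y_j$ in $T$ and $x_k=y_k$ for $k\neq i,j$. Let $Pf(x)=\frac1{\deg(x)}\sum_{y\sim x}f(y)$ be the simple random walk operator on $\ell^2(\mathrm{DL}(q,q,q))$ (complex-valued functions). Let $A_2=\{k\in\mathbb Z^3:k_1+k_2+k_3=0\}$. For $n\ge2$ let $B_n=\{k\in A_2:k_1,k_2\ge0,\ k_3\ge-n\}$, with boundary $\partial B_n=\{k\in B_n: k_1=0\text{ or }k_2=0\text{ or }k_3=-n\}$ and interior $B_n^o=B_n\setminus\partial B_n$.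 For $m\in B_n^o$ put $$\lambda_{m,n}=\tfrac13\Bigl(\cos\tfrac{2\pi(m_1-m_2)}{3n}+\cos\tfrac{2\pi(m_2-m_3)}{3n}+\cos\tfrac{2\pi(m_3-m_1)}{3n}\Bigr),$$ $$\psi_{m,n}(k)=\frac1{\sqrt3\,n}\sum_{\sigma\in S_3}\operatorname{sign}(\sigma)\exp\Bigl(\operatorname{sign}(\sigma)\frac{2\pi i}{3n}\langle m,\sigma k\rangle\Bigr),\qquad (\sigma k)_i=k_{\sigma^{-1}(i)},\quad k\in A_2.$$ Then 1. $\operatorname{spec}(P)=[-\tfrac12,1]$. 2. $\operatorname{spec}(P)$ is the closure of $\Lambda=\{\lambda_{m,n}:n\ge2,\ m\in B_n^o\}$, and $\Lambda$ is exactly the set of eigenvalues of $P$. 3. For every $n\ge2$ and all $m,m'\in B_n^o$: (a) $\psi_{m,n}=0$ on $\partial B_n$; (b) $\sum_{k\in B_n}\psi_{m,n}(k)\overline{\psi_{m',n}(k)}$ equals $1$ if $m=m'$ and $0$ otherwise; (c) $Q_n\psi_{m,n}=\lambda_{m,n}\psi_{m,n}$ on $B_n$, where $Q_nf(k)=\frac16\sum_{i\ne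 j}f(k+e_i-e_j)$ for $k\in B_n^o$ and $Q_nf(k)=0$ for $k\in\partial B_n$. -/

import Mathlib

/-!  The homogeneous tree with a distinguished end, horocyclic products, Diestel-Leader graphs,
simple random walk on `ℓ²`, and the triangles in the lattice `A₂` with their explicit
eigenfunctions. -/

namespace DiestelLeader

/-! ### The homogeneous tree `T_q`

Fix an end `ω` of the tree and label the `q` edges from every vertex to its successors (the
neighbours away from `ω`) bijectively by `ℤ/q`, so that along the geodesic from any vertex to `ω`
only finitely many labels are non-zero.  A vertex is then determined by its horocycle index `k` and
by the labels read along its geodesic to `ω`: `label i` is the label of the edge of that geodesic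
which joins the horocycles `i - 1` and `i` (`i ≤ k`). -/

/-- The vertices of `T_q`. -/
@[ext]
structure TreeVertex (q : ℕ) where
  level : ℤ
  label : ℤ →₀ ZMod q
  label_eq_zero : ∀ i, level < i → label i = 0

namespace TreeVertex

variable {q : ℕ}

/-- The predecessor `x⁻` of `x`, the next vertex on the geodesic from `x` to the end `ω`. -/
noncomputable def pred (x : TreeVertex q) : TreeVertex q where
  level := x.level - 1
  label := x.label.erase x.level
  label_eq_zero i hi := by
    rcases eq_or_ne i x.level with h | h
    · rw [h, Finsupp.erase_same]
    · rw [Finsupp.erase_ne h]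
      exact x.label_eq_zero i (by omega)

/-- The successor of `x` at the end of the edge with label `l`. -/
noncomputable def succ (x : TreeVertex q) (l : ZMod q) : TreeVertex q where
  level := x.level + 1
  label := x.label.update (x.level + 1) l
  label_eq_zero i hi := by
    rw [Finsupp.update_apply, if_neg (by omega)]
    exact x.label_eq_zero i (by omega)

theorem pred_succ (x : TreeVertex q) (l : ZMod q) : (x.succ l).pred = x := by
  ext i
  · simp [pred, succ]
  · by_cases h : i = x.level + 1
    · simp [pred, succ, h, x.label_eq_zero]
    · simp [pred, succ, Finsupp.erase_ne h, Finsupp.update_apply, h]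

theorem succ_pred (x : TreeVertex q) : x.pred.succ (x.label x.level) = x := by
  ext i
  · simp [pred, succ]
  · by_cases h : i = x.level
    · simp [pred, succ, h, Finsupp.update_apply]
    · simp [pred, succ, Finsupp.update_apply, Finsupp.erase_ne h, h]

theorem succ_injective (x : TreeVertex q) : Function.Injective x.succ := by
  intro l m h
  have := congrArg (fun y => y.label (x.level + 1)) h
  simpa [succ, Finsupp.update_apply] using this

theorem pred_eq_iff {x y : TreeVertex q} : y.pred = x ↔ ∃ l, x.succ l = y := by
  constructor
  · rintro rfl
    exact ⟨_, succ_pred y⟩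
  · rintro ⟨l, rfl⟩
    exact pred_succ x l

@[simp] theorem level_pred (x : TreeVertex q) : x.pred.level = x.level - 1 := rfl

@[simp] theorem level_succ (x : TreeVertex q) (l : ZMod q) : (x.succ l).level = x.level + 1 := rfl

/-- The Busemann function (horocycle index, increasing by one from a vertex to its successors) of
`T_q` with respect to `ω`, normalized to vanish at the origin (level `0`, all labels `0`). -/
def hor (x : TreeVertex q) : ℤ := x.level

end TreeVertex

/-- The tree `T_q`: two vertices are neighbours if one is the predecessor of the other. -/
def tree (q : ℕ) : SimpleGraph (TreeVertex q) where
  Adj x y := x.pred = y ∨ y.pred = x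
  symm := ⟨fun _ _ h => h.symm⟩
  loopless := ⟨fun x h => by
    have := congrArg TreeVertex.level (h.elim id id)
    simp at this⟩

section TreeFacts

variable {q : ℕ}

theorem tree_adj {x y : TreeVertex q} : (tree q).Adj x y ↔ x.pred = y ∨ y.pred = x := Iff.rfl

/-- Every vertex of `T_q` has exactly `q + 1` neighbours. -/
theorem tree_ncard_neighborSet [NeZero q] (x : TreeVertex q) :
    ((tree q).neighborSet x).ncard = q + 1 := by
  have h : (tree q).neighborSet x = insert x.pred (Set.range x.succ) := by
    ext y
    simp only [SimpleGraph.mem_neighborSet, tree_adj, TreeVertex.pred_eq_iff (x := x) (y := y),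
      Set.mem_insert_iff, Set.mem_range, eq_comm (a := x.pred)]
  rw [h, Set.ncard_insert_of_notMem _ (Set.toFinite _)]
  · rw [← Set.image_univ, Set.ncard_image_of_injective _ x.succ_injective, Set.ncard_univ,
      Nat.card_zmod]
  · rintro ⟨l, hl⟩
    have := congrArg TreeVertex.level hl
    simp only [TreeVertex.level_succ, TreeVertex.level_pred] at this
    omega

/-- `T_q` has no cycles. -/
theorem tree_isAcyclic (q : ℕ) : (tree q).IsAcyclic := by
  -- removing the edge from `x` to `x⁻` separates the descendants of `x` from all other vertices
  have key : ∀ x : TreeVertex q, ¬ ((tree q).deleteEdges {s(x, x.pred)}).Reachable x x.pred := by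
    intro x
    let S : TreeVertex q → Prop := fun y => x.level ≤ y.level ∧ ∀ i ≤ x.level, y.label i = x.label i
    have down : ∀ y : TreeVertex q, S y.pred → S y := by
      rintro y ⟨h1, h2⟩
      simp only [TreeVertex.level_pred] at h1
      refine ⟨by omega, fun i hi => ?_⟩
      rw [← h2 i hi]
      exact (Finsupp.erase_ne (by omega)).symm
    have up : ∀ y : TreeVertex q, S y → y ≠ x → S y.pred := by
      rintro y ⟨h1, h2⟩ hne
      have hlt : x.level < y.level := by
        rcases h1.lt_or_eq with h | h
        · exact h
        · exfalso
          apply hne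
          ext i
          · exact h.symm
          · rcases le_or_gt i x.level with hi | hi
            · exact h2 i hi
            · rw [x.label_eq_zero i hi, y.label_eq_zero i (h ▸ hi)]
      refine ⟨by simp only [TreeVertex.level_pred]; omega, fun i hi => ?_⟩
      rw [← h2 i hi]
      exact Finsupp.erase_ne (by omega)
    have step : ∀ y z, ((tree q).deleteEdges {s(x, x.pred)}).Adj y z → S y → S z := by
      intro y z hyz hy
      rw [SimpleGraph.deleteEdges_adj] at hyz
      rcases hyz with ⟨h | h, hn⟩
      · subst h
        refine up y hy ?_
        rintro rfl
        exact hn rfl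
      · subst h
        exact down z hy
    have walk : ∀ y z, ((tree q).deleteEdges {s(x, x.pred)}).Walk y z → S y → S z := by
      intro y z p
      induction p with
      | nil => exact id
      | cons h _ ih => exact fun hy => ih (step _ _ h hy)
    rintro ⟨p⟩
    have := (walk _ _ p ⟨le_rfl, fun _ _ => rfl⟩).1
    simp only [TreeVertex.level_pred] at this
    omega
  rw [SimpleGraph.isAcyclic_iff_forall_isBridge]
  intro e
  induction e with
  | _ x y =>
    intro h
    rw [SimpleGraph.mem_edgeSet, tree_adj] at h
    rw [SimpleGraph.isBridge_iff]
    rcases h with h | h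
    · subst h
      exact key x
    · subst h
      rw [Sym2.eq_swap]
      exact fun h => key y h.symm

/-- `T_q` is connected. -/
theorem tree_connected (q : ℕ) : (tree q).Connected := by
  have h1 : ∀ (n : ℕ) (x : TreeVertex q), ∃ y : TreeVertex q, y.level = x.level - n ∧
      (∀ i, y.label i ≠ 0 → x.label i ≠ 0) ∧ (tree q).Reachable x y := by
    intro n
    induction n with
    | zero => exact fun x => ⟨x, by simp, fun _ h => h, SimpleGraph.Reachable.refl _⟩
    | succ n ih =>
      intro x
      obtain ⟨y, hy, hl, hr⟩ := ih x
      refine ⟨y.pred, by simp [hy]; ring, fun i hi => hl i ?_,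
        hr.trans (SimpleGraph.Adj.reachable (Or.inl rfl))⟩
      intro h0
      apply hi
      by_cases h : i = y.level
      · simp [TreeVertex.pred, h]
      · simp [TreeVertex.pred, Finsupp.erase_ne h, h0]
  let base : ℤ → TreeVertex q := fun k => ⟨k, 0, fun _ _ => rfl⟩
  have h2 : ∀ x : TreeVertex q, ∃ k, ∀ m ≤ k, (tree q).Reachable x (base m) := by
    intro x
    obtain ⟨b, hb⟩ := (x.label.support : Set ℤ).toFinite.bddBelow
    refine ⟨min x.level (b - 1), fun m hm => ?_⟩
    obtain ⟨y, hy, hl, hr⟩ := h1 (x.level - m).toNat x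
    have hlev : y.level = m := by omega
    have : y = base m := by
      ext i
      · exact hlev
      · by_contra hne
        have hs := hb (show i ∈ (x.label.support : Set ℤ) by simpa using hl i hne)
        exact hne (y.label_eq_zero i (by omega))
    rwa [← this]
  have : Nonempty (TreeVertex q) := ⟨base 0⟩
  refine ⟨fun x y => ?_⟩
  obtain ⟨k, hk⟩ := h2 x
  obtain ⟨l, hl⟩ := h2 y
  exact (hk _ (min_le_left k l)).trans (hl _ (min_le_right k l)).symm

theorem tree_isTree (q : ℕ) : (tree q).IsTree := ⟨tree_connected q, tree_isAcyclic q⟩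

end TreeFacts

/-! ### Horocyclic products and Diestel-Leader graphs -/

/-- The vertices of the horocyclic product of the Busemann pairs `(X i, h i)`. -/
def HorocyclicProduct {ι : Type*} [Fintype ι] {X : ι → Type*} (h : ∀ i, X i → ℤ) : Type _ :=
  {x : ∀ i, X i // ∑ i, h i (x i) = 0}

/-- The horocyclic product graph: in exactly two coordinates one moves along an edge (in opposite
vertical directions, since the horocycle indices still add up to zero). -/
def horocyclicGraph {ι : Type*} [Fintype ι] {X : ι → Type*} (G : ∀ i, SimpleGraph (X i))
    (h : ∀ i, X i → ℤ) : SimpleGraph (HorocyclicProduct h) where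
  Adj x y := ∃ i j, i ≠ j ∧ (G i).Adj (x.1 i) (y.1 i) ∧ (G j).Adj (x.1 j) (y.1 j) ∧
    ∀ k, k ≠ i → k ≠ j → x.1 k = y.1 k
  symm := ⟨fun _ _ ⟨i, j, hij, hi, hj, hk⟩ =>
    ⟨i, j, hij, hi.symm, hj.symm, fun k h1 h2 => (hk k h1 h2).symm⟩⟩
  loopless := ⟨fun _ ⟨_, _, _, hi, _⟩ => hi.ne rfl⟩

section DL

variable {ι : Type*} [Fintype ι] [DecidableEq ι]

/-- The vertices of the Diestel-Leader graph `DL(q₁, …, q_d)`. -/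
abbrev DLVertex (q : ι → ℕ) : Type _ :=
  HorocyclicProduct (fun i => (TreeVertex.hor : TreeVertex (q i) → ℤ))

/-- The Diestel-Leader graph `DL(q₁, …, q_d)`. -/
abbrev DL (q : ι → ℕ) : SimpleGraph (DLVertex q) :=
  horocyclicGraph (fun i => tree (q i)) (fun _ => TreeVertex.hor)

/-- The neighbour of `x` obtained by moving to the predecessor in coordinate `i`, and to the
successor with label `l` in coordinate `j`. -/
noncomputable def DL.neighbor {q : ι → ℕ} (x : DLVertex q)
    (p : (p : {p : ι × ι // p.1 ≠ p.2}) × ZMod (q p.1.2)) : DLVertex q :=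
  ⟨Function.update (Function.update x.1 p.1.1.1 (x.1 p.1.1.1).pred) p.1.1.2
      ((x.1 p.1.1.2).succ p.2), by
    obtain ⟨⟨⟨i, j⟩, hij⟩, l⟩ := p
    have hx := x.2
    have hij' : i ≠ j := hij
    have hi : i ∈ (Finset.univ.erase j : Finset ι) := by simp [hij']
    rw [← Finset.add_sum_erase _ _ (Finset.mem_univ j), ← Finset.add_sum_erase _ _ hi] at hx ⊢
    have : ∀ k ∈ (Finset.univ.erase j).erase i, TreeVertex.hor (Function.update
        (Function.update x.1 i (x.1 i).pred) j ((x.1 j).succ l) k) = TreeVertex.hor (x.1 k) := by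
      intro k hk
      simp only [Finset.mem_erase] at hk
      rw [Function.update_of_ne hk.2.1, Function.update_of_ne hk.1]
    rw [Finset.sum_congr rfl this, Function.update_self, Function.update_of_ne hij',
      Function.update_self]
    simp only [TreeVertex.hor, TreeVertex.level_succ, TreeVertex.level_pred] at hx ⊢
    linarith⟩

theorem DL.range_neighbor {q : ι → ℕ} (x : DLVertex q) :
    Set.range (DL.neighbor x) = (DL q).neighborSet x := by
  ext y
  constructor
  · rintro ⟨⟨⟨⟨i, j⟩, hij⟩, l⟩, rfl⟩
    have hij' : i ≠ j := hij
    refine ⟨i, j, hij', Or.inl ?_, Or.inr ?_, fun k hi hj => ?_⟩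
    · simp [DL.neighbor, Function.update_of_ne hij']
    · simp [DL.neighbor, TreeVertex.pred_succ]
    · simp [DL.neighbor, Function.update_of_ne hi, Function.update_of_ne hj]
  · -- the two moves have opposite directions because the horocycle indices sum to zero
    have main : ∀ i j, i ≠ j → (x.1 i).pred = y.1 i → (tree (q j)).Adj (x.1 j) (y.1 j) →
        (∀ k, k ≠ i → k ≠ j → x.1 k = y.1 k) → ∃ p, DL.neighbor x p = y := by
      intro i j hij hi hj hk
      have hsum : (x.1 i).level + (x.1 j).level = (y.1 i).level + (y.1 j).level := by
        have hx := x.2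
        have hy := y.2
        have hi' : i ∈ (Finset.univ.erase j : Finset ι) := by simp [hij]
        rw [← Finset.add_sum_erase _ _ (Finset.mem_univ j), ← Finset.add_sum_erase _ _ hi'] at hx hy
        have : ∀ k ∈ (Finset.univ.erase j).erase i,
            TreeVertex.hor (y.1 k) = TreeVertex.hor (x.1 k) := by
          intro k hk'
          simp only [Finset.mem_erase] at hk'
          rw [hk k hk'.1 hk'.2.1]
        rw [Finset.sum_congr rfl this] at hy
        simp only [TreeVertex.hor] at hx hy
        linarith
      have hli : (y.1 i).level = (x.1 i).level - 1 := by rw [← hi]; rfl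
      have hj' : (y.1 j).pred = x.1 j := by
        rcases hj with h | h
        · have : (y.1 j).level = (x.1 j).level - 1 := by rw [← h]; rfl
          omega
        · exact h
      obtain ⟨l, hl⟩ := TreeVertex.pred_eq_iff.1 hj'
      refine ⟨⟨⟨(i, j), hij⟩, l⟩, Subtype.ext (funext fun k => ?_)⟩
      by_cases hkj : k = j
      · subst hkj
        simp [DL.neighbor, hl]
      · by_cases hki : k = i
        · subst hki
          simp [DL.neighbor, Function.update_of_ne hkj, hi]
        · simp [DL.neighbor, Function.update_of_ne hkj, Function.update_of_ne hki, hk k hki hkj]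
    rintro ⟨i, j, hij, hi, hj, hk⟩
    rcases hi with hi | hi
    · exact main i j hij hi hj hk
    · rcases hj with hj | hj
      · exact main j i hij.symm hj (Or.inr hi) fun k h1 h2 => hk k h2 h1
      · exfalso
        have hx := x.2
        have hy := y.2
        have hi' : i ∈ (Finset.univ.erase j : Finset ι) := by simp [hij]
        rw [← Finset.add_sum_erase _ _ (Finset.mem_univ j), ← Finset.add_sum_erase _ _ hi'] at hx hy
        have : ∀ k ∈ (Finset.univ.erase j).erase i,
            TreeVertex.hor (y.1 k) = TreeVertex.hor (x.1 k) := by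
          intro k hk'
          simp only [Finset.mem_erase] at hk'
          rw [hk k hk'.1 hk'.2.1]
        rw [Finset.sum_congr rfl this] at hy
        have e1 := congrArg TreeVertex.level hi
        have e2 := congrArg TreeVertex.level hj
        simp only [TreeVertex.level_pred] at e1 e2
        simp only [TreeVertex.hor] at hx hy
        omega

theorem DL.neighbor_injective {q : ι → ℕ} (x : DLVertex q) :
    Function.Injective (DL.neighbor x) := by
  have lev : ∀ (p : (p : {p : ι × ι // p.1 ≠ p.2}) × ZMod (q p.1.2)) (k : ι),
      ((DL.neighbor x p).1 k).level =
        (x.1 k).level + (if k = p.1.1.2 then 1 else if k = p.1.1.1 then -1 else 0) := by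
    rintro ⟨⟨⟨i, j⟩, hij⟩, l⟩ k
    by_cases hkj : k = j
    · subst hkj
      simp [DL.neighbor]
    · by_cases hki : k = i
      · subst hki
        simp [DL.neighbor, Function.update_of_ne hkj, hkj]
        ring
      · simp [DL.neighbor, Function.update_of_ne hkj, Function.update_of_ne hki, hkj, hki]
  rintro ⟨⟨⟨i, j⟩, hij⟩, l⟩ ⟨⟨⟨i', j'⟩, hij'⟩, l'⟩ h
  have h1 : i ≠ j := hij
  have e : ∀ k, (if k = j then (1 : ℤ) else if k = i then -1 else 0) =
      (if k = j' then 1 else if k = i' then -1 else 0) := by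
    intro k
    have := congrArg (fun y => (y.1 k).level) h
    simp only [lev] at this
    exact add_left_cancel this
  have hj : j = j' := by
    have := e j
    by_contra hne
    simp only [if_true, if_neg hne] at this
    split_ifs at this
    omega
  subst hj
  have hi : i = i' := by
    have := e i
    by_contra hne
    simp [h1, hne] at this
  subst hi
  have := congrArg (fun y => y.1 j) h
  simp only [DL.neighbor, Function.update_self] at this
  rw [TreeVertex.succ_injective _ this]

noncomputable instance {q : ι → ℕ} [∀ i, NeZero (q i)] : (DL q).LocallyFinite := fun x =>
  Fintype.ofEquiv _ ((Equiv.ofInjective _ (DL.neighbor_injective x)).trans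
    (Equiv.setCongr (DL.range_neighbor x)))

/-- The vertex degree of `DL(q₁, …, q_d)` is `(d - 1)(q₁ + ⋯ + q_d)`. -/
theorem DL.isRegularOfDegree (q : ι → ℕ) [∀ i, NeZero (q i)] :
    (DL q).IsRegularOfDegree ((Fintype.card ι - 1) * ∑ i, q i) := by
  intro x
  rw [← SimpleGraph.card_neighborSet_eq_degree, ← Fintype.card_congr
    ((Equiv.ofInjective _ (DL.neighbor_injective x)).trans
      (Equiv.setCongr (DL.range_neighbor x))), Fintype.card_sigma]
  simp only [ZMod.card]
  rw [← Finset.sum_subtype (p := fun p : ι × ι => p.1 ≠ p.2)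
    (Finset.univ.filter fun p : ι × ι => p.1 ≠ p.2) (by simp) (fun p => q p.2), Finset.sum_filter, Fintype.sum_prod_type, Finset.sum_comm, Finset.mul_sum]
  refine Finset.sum_congr rfl fun j _ => ?_
  rw [← Finset.sum_filter]
  change ∑ a with a ≠ j, q j = _
  rw [Finset.sum_const, smul_eq_mul]
  congr 1
  rw [Finset.filter_ne', Finset.card_erase_of_mem (Finset.mem_univ j), Finset.card_univ]

end DL

/-! ### The simple random walk operator on `ℓ²` -/

section SRW

variable {V : Type*} (G : SimpleGraph V) [G.LocallyFinite]

/-- `(Pf)(x) = ∑_y p(x,y) f(y)`, where `p(x,y) = 1/deg(x)` if `y ∼ x`, and `0` otherwise. -/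
noncomputable def srwFun (f : V → ℂ) (x : V) : ℂ :=
  (1 / (G.degree x : ℂ)) * ∑ y ∈ G.neighborFinset x, f y

theorem srwFun_norm_sq_le (f : V → ℂ) (x : V) :
    ‖srwFun G f x‖ ^ 2 ≤ ∑ y ∈ G.neighborFinset x, ‖f y‖ ^ 2 := by
  unfold srwFun
  rcases Nat.eq_zero_or_pos (G.degree x) with h | h
  · simp [h]
    positivity
  · have hd : (1 : ℝ) ≤ G.degree x := by exact_mod_cast h
    have h1 : ‖∑ y ∈ G.neighborFinset x, f y‖ ^ 2 ≤
        (G.degree x : ℝ) * ∑ y ∈ G.neighborFinset x, ‖f y‖ ^ 2 := by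
      calc ‖∑ y ∈ G.neighborFinset x, f y‖ ^ 2 ≤ (∑ y ∈ G.neighborFinset x, ‖f y‖) ^ 2 := by
            gcongr
            exact norm_sum_le _ _
        _ ≤ _ := by
            rw [← G.card_neighborFinset_eq_degree]
            exact sq_sum_le_card_mul_sum_sq
    have h0 : 0 ≤ ∑ y ∈ G.neighborFinset x, ‖f y‖ ^ 2 := by positivity
    rw [norm_mul, mul_pow, norm_div, norm_one, Complex.norm_natCast, div_pow, one_pow,
      one_div_mul_eq_div, div_le_iff₀ (by positivity)]
    nlinarith

theorem sum_srwFun_le {D : ℕ} (hD : ∀ x, G.degree x ≤ D) (f : lp (fun _ : V => ℂ) 2)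
    (s : Finset V) : ∑ x ∈ s, ‖srwFun G f x‖ ^ (2 : ENNReal).toReal ≤
      (Real.sqrt D * ‖f‖) ^ (2 : ENNReal).toReal := by
  classical
  have h2 := lp.sum_rpow_le_norm_rpow (p := 2) (by simp) f (s.biUnion fun x => G.neighborFinset x)
  simp only [ENNReal.toReal_ofNat, Real.rpow_ofNat] at h2 ⊢
  rw [mul_pow, Real.sq_sqrt (by positivity)]
  calc ∑ x ∈ s, ‖srwFun G f x‖ ^ 2 ≤ ∑ x ∈ s, ∑ y ∈ G.neighborFinset x, ‖f y‖ ^ 2 :=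
        Finset.sum_le_sum fun x _ => srwFun_norm_sq_le G f x
    _ = ∑ y ∈ s.biUnion (fun x => G.neighborFinset x), ∑ x ∈ s.filter (fun x => G.Adj y x), ‖f y‖ ^ 2 := by
        apply Finset.sum_comm'
        intro x y
        simp only [SimpleGraph.mem_neighborFinset, Finset.mem_filter, Finset.mem_biUnion]
        constructor
        · rintro ⟨hx, h⟩
          exact ⟨⟨hx, h.symm⟩, x, hx, h⟩
        · rintro ⟨⟨hx, h⟩, _⟩
          exact ⟨hx, h.symm⟩
    _ ≤ ∑ y ∈ s.biUnion (fun x => G.neighborFinset x), D * ‖f y‖ ^ 2 := by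
        refine Finset.sum_le_sum fun y _ => ?_
        rw [Finset.sum_const, nsmul_eq_mul]
        gcongr
        refine le_trans (Finset.card_le_card ?_) (hD y)
        intro x hx
        simpa using (Finset.mem_filter.1 hx).2
    _ ≤ D * ‖f‖ ^ 2 := by
        rw [← Finset.mul_sum]
        gcongr

/-- The simple random walk operator `P` on `ℓ²(V)`, for a graph with bounded vertex degrees. -/
noncomputable def srw {D : ℕ} (hD : ∀ x, G.degree x ≤ D) :
    lp (fun _ : V => ℂ) 2 →L[ℂ] lp (fun _ : V => ℂ) 2 :=
  LinearMap.mkContinuous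
    { toFun := fun f => ⟨srwFun G f, memℓp_gen' (sum_srwFun_le G hD f)⟩
      map_add' := fun f g => by
        ext x
        simp only [srwFun, lp.coeFn_add, Pi.add_apply, Finset.sum_add_distrib, mul_add]
      map_smul' := fun c f => by
        ext x
        simp only [srwFun, lp.coeFn_smul, Pi.smul_apply, smul_eq_mul, RingHom.id_apply,
          ← Finset.mul_sum]
        ring }
    (Real.sqrt D)
    (fun f => lp.norm_le_of_forall_sum_le (by simp) (by positivity) (sum_srwFun_le G hD f))

theorem srw_apply {D : ℕ} (hD : ∀ x, G.degree x ≤ D) (f : lp (fun _ : V => ℂ) 2) (x : V) :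
    srw G hD f x = (1 / (G.degree x : ℂ)) * ∑ y ∈ G.neighborFinset x, f y := rfl

end SRW

/-- The simple random walk operator on `ℓ²(DL(q,q,q))`. -/
noncomputable def srwDL3 (q : ℕ) [NeZero q] :
    lp (fun _ : DLVertex (fun _ : Fin 3 => q) => ℂ) 2 →L[ℂ]
      lp (fun _ : DLVertex (fun _ : Fin 3 => q) => ℂ) 2 :=
  srw (DL (fun _ : Fin 3 => q)) (fun x => (DL.isRegularOfDegree (fun _ : Fin 3 => q) x).le)

/-! ### Triangles in the lattice `A₂` and their Dirichlet eigenfunctions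

Coordinates are numbered `0, 1, 2`. -/

/-- The triangle `B_n` in `A₂ = {k ∈ ℤ³ : k₁ + k₂ + k₃ = 0}`. -/
noncomputable def triangle (n : ℕ) : Finset (Fin 3 → ℤ) :=
  (Fintype.piFinset fun _ : Fin 3 => Finset.Icc (-(n : ℤ)) n).filter
    fun k => ∑ i, k i = 0 ∧ 0 ≤ k 0 ∧ 0 ≤ k 1 ∧ -(n : ℤ) ≤ k 2

theorem mem_triangle {n : ℕ} {k : Fin 3 → ℤ} :
    k ∈ triangle n ↔ ∑ i, k i = 0 ∧ 0 ≤ k 0 ∧ 0 ≤ k 1 ∧ -(n : ℤ) ≤ k 2 := by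
  simp only [triangle, Finset.mem_filter, Fintype.mem_piFinset, Finset.mem_Icc, Fin.sum_univ_three,
    Fin.forall_fin_succ, Fin.succ_zero_eq_one, Fin.succ_one_eq_two, IsEmpty.forall_iff, and_true]
  omega

/-- The boundary of `B_n`. -/
noncomputable def triangleBoundary (n : ℕ) : Finset (Fin 3 → ℤ) :=
  (triangle n).filter fun k => k 0 = 0 ∨ k 1 = 0 ∨ k 2 = -(n : ℤ)

/-- The interior of `B_n`. -/
noncomputable def triangleInterior (n : ℕ) : Finset (Fin 3 → ℤ) :=
  triangle n \ triangleBoundary n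

theorem mem_triangleInterior {n : ℕ} {k : Fin 3 → ℤ} :
    k ∈ triangleInterior n ↔ ∑ i, k i = 0 ∧ 0 < k 0 ∧ 0 < k 1 ∧ -(n : ℤ) < k 2 := by
  simp only [triangleInterior, triangleBoundary, Finset.mem_sdiff, Finset.mem_filter, mem_triangle]
  omega

/-- The transition operator `Q` of simple random walk on `A₂`:
`Qf(k) = (1/6) ∑_{i ≠ j} f(k + e_i - e_j)`. -/
noncomputable def latticeQ (f : (Fin 3 → ℤ) → ℂ) (k : Fin 3 → ℤ) : ℂ :=
  (1 / 6) * ∑ i, ∑ j ∈ Finset.univ.erase i, f (k + Pi.single i 1 - Pi.single j 1)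

/-- The operator `Q_n` on functions on `B_n` that vanish on the boundary. -/
noncomputable def dirichletQ (n : ℕ) (f : (Fin 3 → ℤ) → ℂ) (k : Fin 3 → ℤ) : ℂ :=
  if k ∈ triangleInterior n then latticeQ f k else 0

/-- `λ_{m,n}`. -/
noncomputable def eigenvalue (m : Fin 3 → ℤ) (n : ℕ) : ℝ :=
  (1 / 3) * (Real.cos (2 * Real.pi * (m 0 - m 1) / (3 * n)) +
    Real.cos (2 * Real.pi * (m 1 - m 2) / (3 * n)) +
    Real.cos (2 * Real.pi * (m 2 - m 0) / (3 * n)))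

/-- `ψ_{m,n}(k) = (1/(√3 n)) ∑_σ sign(σ) exp(sign(σ) (2πi/(3n)) ⟨m, σk⟩)`, where
`(σk)_i = k_{σ⁻¹(i)}`. -/
noncomputable def psi (m : Fin 3 → ℤ) (n : ℕ) (k : Fin 3 → ℤ) : ℂ :=
  (1 / ((Real.sqrt 3 : ℂ) * n)) * ∑ σ : Equiv.Perm (Fin 3),
    ((Equiv.Perm.sign σ : ℤ) : ℂ) * Complex.exp (((Equiv.Perm.sign σ : ℤ) : ℂ) *
      (2 * Real.pi * Complex.I / (3 * n)) * ((∑ i, m i * k (σ⁻¹ i) : ℤ) : ℂ))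

end DiestelLeader

/-! The walk has a total system of finitely supported eigenfunctions, built by separating the
horocycle levels from the positions inside the trees.

Levels. In the coordinates (a, b) = (k 0, k 1), `psi m n` is an alternating sum of six characters
(`psi_eq_altSum`). The twist by sign(σ) makes the acting group the one generated by reflections in
the lines k i = 0, and with the translations it becomes the affine reflection group of the triangle.
Antisymmetry forces vanishing on the sides. All six characters have the same eigenvalue under the
lattice walk (`latticeQ_psi`). Products of two alternating sums are invariant, so their sum over the
triangle is one sixth of a sum over a period, where characters are orthogonal (`sum_psi_mul_conj`).

Trees. For a vertex v, the function `haar v` is constant along descent from level v onwards, and it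
has mean zero over any sibling set on the level of v. Multiply a function c of the levels by `haar
(v i)` in each coordinate, and cut off to levels at or above those of the v i. The admissible levels
form the interior of a triangle. If c vanishes on its boundary, the walk acts on c alone, as the
Dirichlet lattice walk (`sum_tetra_neighbor`): c kills the flow out of the triangle, and the
mean-zero property kills the flow into the points just outside. So c = `psi m n` gives an
eigenfunction in ℓ².

Totality. Since the `psi m n` span all functions on the interior, every such product lies in the sum
of the eigenspaces (`tetraLp_mem`). A point mass is recovered by telescoping averages over
horocyclic sets in the three coordinates; the successive differences of these averages are multiples
of `haar`, and the averages tend to 0 in ℓ² because q ≥ 2 (`single_mem_closure_eigenspaceSum`).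

Spectrum. A symmetric operator whose eigenspaces for S span a dense subspace has spectrum in the
closure of S and no eigenvalue outside S. It remains to compute the closure of the set of the λ, by
an elementary inequality and the intermediate value theorem (`closure_eigenvalueSet`). -/

namespace DiestelLeader

/-! ### The eigenfunctions in triangle coordinates -/

/-- The character `t ↦ exp(2πi t / (3n))` of `ℤ`. -/
noncomputable def rootChar (n : ℕ) (t : ℤ) : ℂ :=
  Complex.exp (2 * Real.pi * Complex.I / (3 * n) * (t : ℂ))

theorem rootChar_add (n : ℕ) (s t : ℤ) : rootChar n (s + t) = rootChar n s * rootChar n t := by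
  rw [rootChar, rootChar, rootChar, ← Complex.exp_add]
  push_cast
  ring_nf

theorem rootChar_three_mul {n : ℕ} (hn : n ≠ 0) (t : ℤ) : rootChar n (3 * n * t) = 1 := by
  have hn' : (n : ℂ) ≠ 0 := by exact_mod_cast hn
  rw [rootChar, Complex.exp_eq_one_iff]
  refine ⟨t, ?_⟩
  push_cast
  field_simp

theorem rootChar_add_three_mul {n : ℕ} (hn : n ≠ 0) (s t : ℤ) :
    rootChar n (s + 3 * n * t) = rootChar n s := by
  rw [rootChar_add, rootChar_three_mul hn, mul_one]

theorem rootChar_congr {n : ℕ} (hn : n ≠ 0) {s t : ℤ} (u : ℤ) (h : s = t + 3 * n * u) :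
    rootChar n s = rootChar n t := by
  rw [h, rootChar_add_three_mul hn]

theorem rootChar_eq_one_iff {n : ℕ} (hn : n ≠ 0) {t : ℤ} :
    rootChar n t = 1 ↔ (3 * n : ℤ) ∣ t := by
  constructor
  · intro h
    have hn' : (n : ℂ) ≠ 0 := by exact_mod_cast hn
    rw [rootChar, Complex.exp_eq_one_iff] at h
    obtain ⟨s, hs⟩ := h
    refine ⟨s, ?_⟩
    have hpi : (2 * Real.pi * Complex.I : ℂ) ≠ 0 := Complex.two_pi_I_ne_zero
    have : (t : ℂ) = 3 * n * s := by
      field_simp at hs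
      linear_combination hs
    exact_mod_cast this
  · rintro ⟨s, rfl⟩
    exact rootChar_three_mul hn s

theorem conj_rootChar (n : ℕ) (t : ℤ) : (starRingEnd ℂ) (rootChar n t) = rootChar n (-t) := by
  rw [rootChar, rootChar, ← Complex.exp_conj]
  congr 1
  simp only [map_mul, map_div₀, Complex.conj_ofReal, Complex.conj_I, Complex.conj_natCast,
    Complex.conj_ofNat, map_intCast]
  push_cast
  ring

theorem rootChar_nsmul (n : ℕ) (t : ℤ) (j : ℕ) : rootChar n (t * j) = rootChar n t ^ j := by
  rw [rootChar, rootChar, ← Complex.exp_nat_mul]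
  push_cast
  ring_nf

/-- The alternating sum of the six characters in the orbit of `(p, r)`. -/
noncomputable def altSum (n : ℕ) (p r a b : ℤ) : ℂ :=
  rootChar n (p * a + r * b) + rootChar n (-r * a + (p - r) * b) +
    rootChar n ((r - p) * a + -p * b) - rootChar n (-r * a + -p * b) -
    rootChar n (p * a + (p - r) * b) - rootChar n ((r - p) * a + r * b)

theorem sum_perm_fin_three {M : Type*} [AddCommMonoid M] (f : Equiv.Perm (Fin 3) → M) :
    ∑ σ, f σ = f 1 + (f (Equiv.swap 0 1) + (f (Equiv.swap 0 2) + (f (Equiv.swap 1 2) +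
      (f (Equiv.swap 0 1 * Equiv.swap 1 2) + f (Equiv.swap 1 2 * Equiv.swap 0 1))))) := by
  have h : (Finset.univ : Finset (Equiv.Perm (Fin 3))) = {1, Equiv.swap 0 1, Equiv.swap 0 2,
      Equiv.swap 1 2, Equiv.swap 0 1 * Equiv.swap 1 2, Equiv.swap 1 2 * Equiv.swap 0 1} := by
    decide
  rw [h, Finset.sum_insert (by decide), Finset.sum_insert (by decide),
    Finset.sum_insert (by decide), Finset.sum_insert (by decide), Finset.sum_insert (by decide),
    Finset.sum_singleton]

/-- As k 2 = -k 0 - k 1, the pairing ⟨m, k⟩ is p a + r b with p = m 0 - m 2 and r = m 1 - m 2. An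
odd σ contributes the pairing with -σk, and the maps k ↦ -σk for transpositions σ are the
reflections with mirrors k i = 0, parallel to the sides of the triangle. -/
theorem psi_eq_altSum {m k : Fin 3 → ℤ} (n : ℕ) (hk : ∑ i, k i = 0) :
    psi m n k = 1 / ((Real.sqrt 3 : ℂ) * n) *
      altSum n (m 0 - m 2) (m 1 - m 2) (k 0) (k 1) := by
  have h2 : k 2 = -k 0 - k 1 := by
    rw [Fin.sum_univ_three] at hk
    linarith
  have pos : ∀ σ : Equiv.Perm (Fin 3), Equiv.Perm.sign σ = 1 →
      ((Equiv.Perm.sign σ : ℤ) : ℂ) * Complex.exp (((Equiv.Perm.sign σ : ℤ) : ℂ) *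
      (2 * Real.pi * Complex.I / (3 * n)) * ((∑ i, m i * k (σ⁻¹ i) : ℤ) : ℂ)) =
      rootChar n (∑ i, m i * k (σ⁻¹ i)) := by
    intro σ hσ
    rw [hσ, rootChar]
    simp
  have neg : ∀ σ : Equiv.Perm (Fin 3), Equiv.Perm.sign σ = -1 →
      ((Equiv.Perm.sign σ : ℤ) : ℂ) * Complex.exp (((Equiv.Perm.sign σ : ℤ) : ℂ) *
      (2 * Real.pi * Complex.I / (3 * n)) * ((∑ i, m i * k (σ⁻¹ i) : ℤ) : ℂ)) =
      -rootChar n (-∑ i, m i * k (σ⁻¹ i)) := by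
    intro σ hσ
    rw [hσ, rootChar]
    simp
  rw [psi, sum_perm_fin_three, pos 1 (by decide), neg (Equiv.swap 0 1) (by decide),
    neg (Equiv.swap 0 2) (by decide), neg (Equiv.swap 1 2) (by decide),
    pos (Equiv.swap 0 1 * Equiv.swap 1 2) (by decide),
    pos (Equiv.swap 1 2 * Equiv.swap 0 1) (by decide)]
  simp only [Fin.sum_univ_three]
  have e : ∀ (σ : Equiv.Perm (Fin 3)) (i j : Fin 3), σ⁻¹ i = j → k (σ⁻¹ i) = k j :=
    fun σ i j h => by rw [h]
  rw [e 1 0 0 (by decide), e 1 1 1 (by decide), e 1 2 2 (by decide),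
    e (Equiv.swap 0 1) 0 1 (by decide), e (Equiv.swap 0 1) 1 0 (by decide),
    e (Equiv.swap 0 1) 2 2 (by decide),
    e (Equiv.swap 0 2) 0 2 (by decide), e (Equiv.swap 0 2) 1 1 (by decide),
    e (Equiv.swap 0 2) 2 0 (by decide),
    e (Equiv.swap 1 2) 0 0 (by decide), e (Equiv.swap 1 2) 1 2 (by decide),
    e (Equiv.swap 1 2) 2 1 (by decide),
    e (Equiv.swap 0 1 * Equiv.swap 1 2) 0 2 (by decide),
    e (Equiv.swap 0 1 * Equiv.swap 1 2) 1 0 (by decide),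
    e (Equiv.swap 0 1 * Equiv.swap 1 2) 2 1 (by decide),
    e (Equiv.swap 1 2 * Equiv.swap 0 1) 0 1 (by decide),
    e (Equiv.swap 1 2 * Equiv.swap 0 1) 1 2 (by decide),
    e (Equiv.swap 1 2 * Equiv.swap 0 1) 2 0 (by decide), h2, altSum]
  ring_nf

/-! ### Antisymmetry under the affine reflection group -/

section Symmetry

variable {n : ℕ} (p r a b : ℤ)

theorem altSum_reflect_left : altSum n p r (-a) (a + b) = -altSum n p r a b := by
  simp only [altSum]
  ring_nf

theorem altSum_reflect_right : altSum n p r (a + b) (-b) = -altSum n p r a b := by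
  simp only [altSum]
  ring_nf

variable {p r}

/-- Translation by n(1, 1, -2) is the product of the reflections in k 2 = 0 and k 2 = -n. It shifts
each exponent by n times the sum of the two frequency components, a multiple of 3n because 3 ∣ p + r
passes to the whole orbit. -/
theorem altSum_add_diag (hn : n ≠ 0) (h : (3 : ℤ) ∣ p + r) :
    altSum n p r (a + n) (b + n) = altSum n p r a b := by
  obtain ⟨u, hu⟩ := h
  obtain rfl : r = 3 * u - p := by linarith
  simp only [altSum]
  congr 1
  · congr 1
    · congr 1
      · congr 1
        · congr 1
          · exact rootChar_congr hn u (by ring)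
          · exact rootChar_congr hn (p - 2 * u) (by ring)
        · exact rootChar_congr hn (u - p) (by ring)
      · exact rootChar_congr hn (-u) (by ring)
    · exact rootChar_congr hn (p - u) (by ring)
  · exact rootChar_congr hn (2 * u - p) (by ring)

theorem altSum_add_three_mul (hn : n ≠ 0) :
    altSum n p r (a + 3 * n) b = altSum n p r a b := by
  simp only [altSum]
  congr 1
  · congr 1
    · congr 1
      · congr 1
        · congr 1
          · exact rootChar_congr hn p (by ring)
          · exact rootChar_congr hn (-r) (by ring)
        · exact rootChar_congr hn (r - p) (by ring)
      · exact rootChar_congr hn (-r) (by ring)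
    · exact rootChar_congr hn p (by ring)
  · exact rootChar_congr hn (r - p) (by ring)

theorem altSum_zero_left : altSum n p r 0 b = 0 := by
  have := altSum_reflect_left (n := n) p r 0 b
  simp only [neg_zero, zero_add] at this
  exact self_eq_neg.1 this

theorem altSum_zero_right : altSum n p r a 0 = 0 := by
  have := altSum_reflect_right (n := n) p r a 0
  simp only [neg_zero, add_zero] at this
  exact self_eq_neg.1 this

theorem altSum_reflect_diag (hn : n ≠ 0) (h : (3 : ℤ) ∣ p + r) :
    altSum n p r (n - b) (n - a) = -altSum n p r a b := by
  have h1 : altSum n p r (-b) (-a) = -altSum n p r a b := by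
    simp only [altSum]
    ring_nf
  rw [← h1, ← altSum_add_diag (-b) (-a) hn h]
  congr 1 <;> ring

end Symmetry

/-! ### Orthogonality by summation over a period -/

/-- The open triangle in the coordinates `(k 0, k 1)`. -/
noncomputable def openTriangle (n : ℕ) : Finset (ℤ × ℤ) :=
  (Finset.Ico 0 (3 * n : ℤ) ×ˢ Finset.Ico 0 (n : ℤ)).filter
    fun x => 0 < x.1 ∧ 0 < x.2 ∧ x.1 + x.2 < n

theorem mem_openTriangle {n : ℕ} {x : ℤ × ℤ} :
    x ∈ openTriangle n ↔ 0 < x.1 ∧ 0 < x.2 ∧ x.1 + x.2 < n := by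
  simp only [openTriangle, Finset.mem_filter, Finset.mem_product, Finset.mem_Ico]
  omega

theorem sum_triangle_eq {n : ℕ} (f : (Fin 3 → ℤ) → ℂ) (hf : ∀ k ∈ triangleBoundary n, f k = 0) :
    ∑ k ∈ triangle n, f k = ∑ k ∈ triangleInterior n, f k := by
  refine (Finset.sum_subset Finset.sdiff_subset fun k hk hk' => hf k ?_).symm
  by_contra h
  exact hk' (Finset.mem_sdiff.2 ⟨hk, h⟩)

theorem sum_triangleInterior_eq {n : ℕ} (g : ℤ → ℤ → ℂ) :
    ∑ k ∈ triangleInterior n, g (k 0) (k 1) = ∑ x ∈ openTriangle n, g x.1 x.2 := by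
  refine Finset.sum_bij' (fun k _ => (k 0, k 1)) (fun x _ => ![x.1, x.2, -x.1 - x.2]) ?_ ?_ ?_ ?_ ?_
  · intro k hk
    rw [mem_triangleInterior, Fin.sum_univ_three] at hk
    rw [mem_openTriangle]
    omega
  · intro x hx
    rw [mem_openTriangle] at hx
    simp only [mem_triangleInterior, Fin.sum_univ_three, Matrix.cons_val]
    omega
  · intro k hk
    rw [mem_triangleInterior, Fin.sum_univ_three] at hk
    ext i
    fin_cases i
    · rfl
    · rfl
    · simp
      omega
  · intro x _
    rfl
  · intro k _
    rfl

/-- A function invariant under the affine reflection group of the triangle and vanishing on its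
mirrors, summed over a period, gives six times its sum over the open triangle. -/
theorem sum_period_eq {n : ℕ} (g : ℤ → ℤ → ℂ)
    (h0 : ∀ a b, g (-a) (a + b) = g a b) (h1 : ∀ a b, g (a + b) (-b) = g a b)
    (hd : ∀ a b, g (a + n) (b + n) = g a b) (h3 : ∀ a b, g (a + 3 * n) b = g a b)
    (z0 : ∀ b, g 0 b = 0) (z1 : ∀ a, g a 0 = 0) :
    ∑ x ∈ Finset.Ico 0 (3 * n : ℤ) ×ˢ Finset.Ico 0 (n : ℤ), g x.1 x.2 =
      6 * ∑ x ∈ openTriangle n, g x.1 x.2 := by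
  set R := Finset.Ico 0 (3 * n : ℤ) ×ˢ Finset.Ico 0 (n : ℤ) with hR
  have memR : ∀ x : ℤ × ℤ, x ∈ R ↔ (0 ≤ x.1 ∧ x.1 < 3 * n) ∧ 0 ≤ x.2 ∧ x.2 < n := by
    simp [hR]
  have z2 : ∀ a, g a (-a) = 0 := fun a => by
    rw [← h0 a (-a), add_neg_cancel, z1]
  -- These are the mirrors that meet the rectangle; each is carried by translations to a line
  -- through the origin.
  have zero : ∀ x : ℤ × ℤ, (x.1 = 0 ∨ x.1 = n ∨ x.1 = 2 * n ∨ x.2 = 0 ∨ x.1 + x.2 = n ∨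
      x.1 + x.2 = 2 * n ∨ x.1 + x.2 = 3 * n) → g x.1 x.2 = 0 := by
    rintro ⟨a, b⟩ h
    dsimp only at h ⊢
    rcases h with h | h | h | h | h | h | h
    · rw [h, z0]
    · have := z0 (b - n)
      rw [← hd] at this
      convert this using 2 <;> linarith
    · have := z0 (b - n - n)
      rw [← hd, ← hd] at this
      convert this using 2 <;> linarith
    · rw [h, z1]
    · have := z2 (a + n)
      rw [← hd, ← hd] at this
      rw [← h3]
      convert this using 2 <;> linarith
    · have := z2 (a - n)
      rw [← hd] at this
      convert this using 2 <;> linarith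
    · have := z2 (a - 3 * n)
      rw [← h3] at this
      convert this using 2 <;> linarith
  have g2 : ∀ a b, g (n - b) (n - a) = g a b := fun a b => by
    have e0 := h0 b (-(a + b))
    have e1 := h1 (-a) (a + b)
    rw [show b + -(a + b) = -a by ring] at e0
    rw [show -a + (a + b) = b by ring] at e1
    rw [← h0 a b, ← e1, ← e0, ← hd (-b) (-a)]
    congr 1 <;> ring
  have key : ∀ (Q : ℤ × ℤ → Prop) [DecidablePred Q] (φ φ' : ℤ × ℤ → ℤ × ℤ),
      (∀ x ∈ openTriangle n, φ x ∈ R ∧ Q (φ x)) → (∀ x ∈ R, Q x → φ' x ∈ openTriangle n) →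
      (∀ x, φ' (φ x) = x) → (∀ x, φ (φ' x) = x) → (∀ x, g (φ x).1 (φ x).2 = g x.1 x.2) →
      ∑ x ∈ R, (if Q x then g x.1 x.2 else 0) = ∑ x ∈ openTriangle n, g x.1 x.2 := by
    intro Q _ φ φ' a1 a2 a3 a4 a5
    rw [← Finset.sum_filter]
    refine (Finset.sum_bij' (fun x _ => φ x) (fun x _ => φ' x) ?_ ?_ ?_ ?_ ?_).symm
    · exact fun x hx => Finset.mem_filter.2 (a1 x hx)
    · exact fun x hx => a2 x (Finset.mem_filter.1 hx).1 (Finset.mem_filter.1 hx).2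
    · exact fun x _ => a3 x
    · exact fun x _ => a4 x
    · exact fun x _ => (a5 x).symm
  -- The rectangle consists of three rhombi [jn, (j+1)n) × [0, n); the mirror a + b = (j+1)n cuts
  -- each into a triangle `U j` and a triangle `D j`.
  let U : ℤ → ℤ × ℤ → Prop := fun j x => j * n < x.1 ∧ 0 < x.2 ∧ x.1 + x.2 < (j + 1) * n
  let D : ℤ → ℤ × ℤ → Prop := fun j x => x.1 < (j + 1) * n ∧ x.2 < n ∧ (j + 1) * n < x.1 + x.2
  have split : ∀ x ∈ R, g x.1 x.2 = (if U 0 x then g x.1 x.2 else 0) +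
      (if U 1 x then g x.1 x.2 else 0) + (if U 2 x then g x.1 x.2 else 0) +
      (if D 0 x then g x.1 x.2 else 0) + (if D 1 x then g x.1 x.2 else 0) +
      (if D 2 x then g x.1 x.2 else 0) := by
    intro x hx
    rw [memR] at hx
    by_cases hz : g x.1 x.2 = 0
    · simp [hz]
    · have := mt (zero x) hz
      simp only [U, D]
      rcases lt_or_ge x.1 n with c | c
      · rcases lt_or_ge (x.1 + x.2) n with c' | c'
        · rw [if_pos (by omega), if_neg (by omega), if_neg (by omega), if_neg (by omega),
            if_neg (by omega), if_neg (by omega)]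
          ring
        · rw [if_neg (by omega), if_neg (by omega), if_neg (by omega), if_pos (by omega),
            if_neg (by omega), if_neg (by omega)]
          ring
      · rcases lt_or_ge x.1 (2 * n) with d | d
        · rcases lt_or_ge (x.1 + x.2) (2 * n) with c' | c'
          · rw [if_neg (by omega), if_pos (by omega), if_neg (by omega), if_neg (by omega),
              if_neg (by omega), if_neg (by omega)]
            ring
          · rw [if_neg (by omega), if_neg (by omega), if_neg (by omega), if_neg (by omega),
              if_pos (by omega), if_neg (by omega)]
            ring
        · rcases lt_or_ge (x.1 + x.2) (3 * n) with c' | c'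
          · rw [if_neg (by omega), if_neg (by omega), if_pos (by omega), if_neg (by omega),
              if_neg (by omega), if_neg (by omega)]
            ring
          · rw [if_neg (by omega), if_neg (by omega), if_neg (by omega), if_neg (by omega),
              if_neg (by omega), if_pos (by omega)]
            ring
  -- The open triangle is carried to each `U j` by the identity or a rotation, and to each `D j` by
  -- an orientation-reversing element of the affine group.
  have u0 := key (U 0) id id (fun x => by simp only [mem_openTriangle, memR, U, id]; omega)
    (fun x => by simp only [mem_openTriangle, memR, U, id]; omega) (fun x => rfl) (fun x => rfl)
    (fun x => rfl)
  have u1 := key (U 1) (fun x => (n + x.2, n - x.1 - x.2)) (fun x => (2 * n - x.1 - x.2, x.1 - n))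
    (fun x => by simp only [mem_openTriangle, memR, U]; omega)
    (fun x => by simp only [mem_openTriangle, memR, U]; omega)
    (fun x => by ext <;> dsimp only <;> ring) (fun x => by ext <;> dsimp only <;> ring) (fun x => by
      have e := h1 (-x.1) (x.1 + x.2)
      rw [h0, ← hd] at e
      rw [← e]
      congr 1 <;> ring)
  have u2 := key (U 2) (fun x => (3 * n - x.1 - x.2, x.1)) (fun x => (x.2, 3 * n - x.1 - x.2))
    (fun x => by simp only [mem_openTriangle, memR, U]; omega)
    (fun x => by simp only [mem_openTriangle, memR, U]; omega)
    (fun x => by ext <;> dsimp only <;> ring) (fun x => by ext <;> dsimp only <;> ring) (fun x => by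
      have e := h0 (x.1 + x.2) (-x.2)
      rw [h1, ← h3] at e
      rw [← e]
      congr 1 <;> ring)
  have d0 := key (D 0) (fun x => (n - x.2, n - x.1)) (fun x => (n - x.2, n - x.1))
    (fun x => by simp only [mem_openTriangle, memR, D]; omega)
    (fun x => by simp only [mem_openTriangle, memR, D]; omega)
    (fun x => by ext <;> dsimp only <;> ring) (fun x => by ext <;> dsimp only <;> ring) (fun x => g2 x.1 x.2)
  have d1 := key (D 1) (fun x => (x.1 + x.2 + n, n - x.2)) (fun x => (x.1 + x.2 - 2 * n, n - x.2))
    (fun x => by simp only [mem_openTriangle, memR, D]; omega)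
    (fun x => by simp only [mem_openTriangle, memR, D]; omega)
    (fun x => by ext <;> dsimp only <;> ring) (fun x => by ext <;> dsimp only <;> ring) (fun x => by
      have e := h1 x.1 x.2
      rw [← hd] at e
      rw [← e]
      congr 1 ; ring)
  have d2 := key (D 2) (fun x => (3 * n - x.1, x.1 + x.2)) (fun x => (3 * n - x.1, x.1 + x.2 - 3 * n))
    (fun x => by simp only [mem_openTriangle, memR, D]; omega)
    (fun x => by simp only [mem_openTriangle, memR, D]; omega)
    (fun x => by ext <;> dsimp only <;> ring) (fun x => by ext <;> dsimp only <;> ring) (fun x => by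
      have e := h0 x.1 x.2
      rw [← h3] at e
      rw [← e]
      congr 1 ; ring)
  rw [Finset.sum_congr rfl split]
  simp only [Finset.sum_add_distrib]
  rw [u0, u1, u2, d0, d1, d2]
  ring

/-- Orthogonality of the characters over a period. -/
theorem sum_rootChar {n : ℕ} (hn : n ≠ 0) (p r : ℤ) (h : (3 : ℤ) ∣ p + r) :
    ∑ x ∈ Finset.Ico 0 (3 * n : ℤ) ×ˢ Finset.Ico 0 (n : ℤ), rootChar n (p * x.1 + r * x.2) =
      if (3 * n : ℤ) ∣ p ∧ (3 * n : ℤ) ∣ r then 3 * (n : ℂ) ^ 2 else 0 := by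
  -- The ratio is an N-th root of unity other than 1, so the geometric sum vanishes.
  have geom : ∀ (N : ℕ) (t : ℤ), (3 * n : ℤ) ∣ t * N → ¬ (3 * n : ℤ) ∣ t →
      ∑ a ∈ Finset.Ico 0 (N : ℤ), rootChar n (t * a) = 0 := by
    intro N t h1 h2
    have e : ∑ a ∈ Finset.Ico 0 (N : ℤ), rootChar n (t * a) =
        ∑ j ∈ Finset.range N, rootChar n t ^ j := by
      refine (Finset.sum_bij (fun (j : ℕ) _ => (j : ℤ)) ?_ ?_ ?_ ?_).symm
      · intro j hj
        simpa using hj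
      · intro i _ j _ hij
        exact_mod_cast hij
      · intro a ha
        rw [Finset.mem_Ico] at ha
        exact ⟨a.toNat, by simp; omega, by omega⟩
      · intro j _
        rw [rootChar_nsmul]
    rw [e, geom_sum_eq (mt (rootChar_eq_one_iff hn).1 h2), ← rootChar_nsmul,
      (rootChar_eq_one_iff hn).2 h1, sub_self, zero_div]
  rw [Finset.sum_product]
  simp only [rootChar_add, ← Finset.mul_sum]
  rw [← Finset.sum_mul]
  by_cases hp : (3 * n : ℤ) ∣ p
  · by_cases hr : (3 * n : ℤ) ∣ r
    · rw [if_pos ⟨hp, hr⟩,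
        Finset.sum_congr rfl fun a _ => (rootChar_eq_one_iff hn).2 (hp.mul_right a),
        Finset.sum_congr rfl fun a _ => (rootChar_eq_one_iff hn).2 (hr.mul_right a)]
      have : (3 * n : ℤ).toNat = 3 * n := by omega
      simp [this]
      ring
    -- Divisibility by 3 makes r n a multiple of 3n, so the sum over only n values of b already runs
    -- over full periods.
    · have h3 : (3 : ℤ) ∣ r := by
        have : (3 : ℤ) ∣ p := (Dvd.intro _ rfl).trans hp
        omega
      rw [if_neg (fun h => hr h.2), geom n r (mul_dvd_mul_right h3 _) hr, mul_zero]
  · have := geom (3 * n) p (by push_cast; exact Dvd.intro_left _ rfl) hp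
    push_cast at this
    rw [if_neg (fun h => hp h.1), this, zero_mul]

/-- The frequencies of the six characters in `altSum`. -/
def orbitFreq (p r : ℤ) : Fin 6 → ℤ × ℤ :=
  ![(p, r), (-r, p - r), (r - p, -p), (-r, -p), (p, p - r), (r - p, r)]

/-- The signs of the six characters in `altSum`. -/
def orbitSign : Fin 6 → ℤ := ![1, 1, 1, -1, -1, -1]

theorem altSum_eq_sum (n : ℕ) (p r a b : ℤ) : altSum n p r a b =
    ∑ j, (orbitSign j : ℂ) * rootChar n ((orbitFreq p r j).1 * a + (orbitFreq p r j).2 * b) := by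
  simp [Fin.sum_univ_succ, orbitSign, orbitFreq, altSum]
  ring

theorem three_dvd_orbitFreq {p r : ℤ} (h : (3 : ℤ) ∣ p + r) (j : Fin 6) :
    (3 : ℤ) ∣ (orbitFreq p r j).1 + (orbitFreq p r j).2 := by
  fin_cases j <;> simp [orbitFreq] <;> omega

/-- The inequalities place (p, r) in an open fundamental triangle, whose six images are disjoint.
All frequency components are below 2n in modulus, so congruent ones differ by -3n, 0 or 3n, which
leaves finitely many linear cases. -/
theorem eq_of_orbitFreq_modEq {n : ℕ} {p r p' r' : ℤ} (h1 : 0 < 2 * p - r) (h2 : 0 < 2 * r - p)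
    (h3 : p + r < 3 * n) (h1' : 0 < 2 * p' - r') (h2' : 0 < 2 * r' - p') (h3' : p' + r' < 3 * n)
    (i j : Fin 6) (hp : (3 * n : ℤ) ∣ (orbitFreq p r i).1 - (orbitFreq p' r' j).1)
    (hr : (3 * n : ℤ) ∣ (orbitFreq p r i).2 - (orbitFreq p' r' j).2) :
    p = p' ∧ r = r' ∧ i = j := by
  obtain ⟨s, hs⟩ := hp
  obtain ⟨t, ht⟩ := hr
  have b1 : ∀ i, |(orbitFreq p r i).1| < 2 * n ∧ |(orbitFreq p r i).2| < 2 * n := by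
    intro i
    simp only [abs_lt]
    fin_cases i <;> simp [orbitFreq] <;> omega
  have b2 : ∀ i, |(orbitFreq p' r' i).1| < 2 * n ∧ |(orbitFreq p' r' i).2| < 2 * n := by
    intro i
    simp only [abs_lt]
    fin_cases i <;> simp [orbitFreq] <;> omega
  have bound : ∀ x y u : ℤ, |x| < 2 * n → |y| < 2 * n → x - y = 3 * n * u →
      u = -1 ∨ u = 0 ∨ u = 1 := by
    intro x y u hx hy h
    rw [abs_lt] at hx hy
    have l : -2 < u := by
      by_contra hu
      nlinarith
    have l' : u < 2 := by
      by_contra hu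
      nlinarith
    omega
  have cs := bound _ _ s (b1 i).1 (b2 j).1 hs
  have ct := bound _ _ t (b1 i).2 (b2 j).2 ht
  clear bound b1 b2
  fin_cases i <;> fin_cases j <;> simp [orbitFreq] at hs ht ⊢ <;>
    rcases cs with rfl | rfl | rfl <;> rcases ct with rfl | rfl | rfl <;> omega

/-- Of the 36 products of characters summed over a period, only the six diagonal ones can survive,
each contributing 3n². Dividing by the six triangles of a period leaves 3n², which explains the
factor 1/(√3 n) in `psi`. -/
theorem sum_altSum_mul_conj {n : ℕ} (hn : n ≠ 0) {p r p' r' : ℤ} (h : (3 : ℤ) ∣ p + r)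
    (h' : (3 : ℤ) ∣ p' + r') (h1 : 0 < 2 * p - r) (h2 : 0 < 2 * r - p)
    (h3 : p + r < 3 * n) (h1' : 0 < 2 * p' - r') (h2' : 0 < 2 * r' - p') (h3' : p' + r' < 3 * n) :
    ∑ x ∈ openTriangle n, altSum n p r x.1 x.2 * (starRingEnd ℂ) (altSum n p' r' x.1 x.2) =
      if p = p' ∧ r = r' then 3 * (n : ℂ) ^ 2 else 0 := by
  have key : ∑ x ∈ Finset.Ico 0 (3 * n : ℤ) ×ˢ Finset.Ico 0 (n : ℤ),
      altSum n p r x.1 x.2 * (starRingEnd ℂ) (altSum n p' r' x.1 x.2) =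
      if p = p' ∧ r = r' then 6 * (3 * (n : ℂ) ^ 2) else 0 := by
    have e : ∀ x : ℤ × ℤ, altSum n p r x.1 x.2 * (starRingEnd ℂ) (altSum n p' r' x.1 x.2) =
        ∑ i, ∑ j, (orbitSign i : ℂ) * (orbitSign j : ℂ) *
          rootChar n (((orbitFreq p r i).1 - (orbitFreq p' r' j).1) * x.1 +
            ((orbitFreq p r i).2 - (orbitFreq p' r' j).2) * x.2) := by
      intro x
      rw [altSum_eq_sum, altSum_eq_sum, map_sum, Finset.sum_mul_sum]
      refine Finset.sum_congr rfl fun i _ => Finset.sum_congr rfl fun j _ => ?_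
      rw [map_mul, conj_rootChar, map_intCast, mul_mul_mul_comm, ← rootChar_add]
      congr 2
      ring
    rw [Finset.sum_congr rfl fun x _ => e x, Finset.sum_comm]
    simp_rw [Finset.sum_comm (t := (Finset.univ : Finset (Fin 6)))
      (s := Finset.Ico 0 (3 * n : ℤ) ×ˢ Finset.Ico 0 (n : ℤ)), ← Finset.mul_sum]
    have e2 : ∀ i j : Fin 6, (orbitSign i : ℂ) * (orbitSign j : ℂ) *
        ∑ x ∈ Finset.Ico 0 (3 * n : ℤ) ×ˢ Finset.Ico 0 (n : ℤ),
          rootChar n (((orbitFreq p r i).1 - (orbitFreq p' r' j).1) * x.1 +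
            ((orbitFreq p r i).2 - (orbitFreq p' r' j).2) * x.2) =
        if i = j then (if p = p' ∧ r = r' then 3 * (n : ℂ) ^ 2 else 0) else 0 := by
      intro i j
      have d1 := three_dvd_orbitFreq h i
      have d2 := three_dvd_orbitFreq h' j
      rw [sum_rootChar hn _ _ (by omega)]
      by_cases hc : (p = p' ∧ r = r') ∧ i = j
      · obtain ⟨⟨rfl, rfl⟩, rfl⟩ := hc
        have hs : (orbitSign i : ℂ) * orbitSign i = 1 := by
          fin_cases i <;> simp [orbitSign]
        simp [hs]
      · rw [if_neg]
        · rw [mul_zero]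
          split_ifs <;> tauto
        · rintro ⟨hp, hr⟩
          have := eq_of_orbitFreq_modEq h1 h2 h3 h1' h2' h3' i j hp hr
          tauto
    simp_rw [e2]
    simp
  rw [sum_period_eq (fun a b => altSum n p r a b * (starRingEnd ℂ) (altSum n p' r' a b))] at key
  · split_ifs at key ⊢ with hc
    · linear_combination key / 6
    · linear_combination key / 6
  · intro a b
    simp only [altSum_reflect_left, map_neg, neg_mul_neg]
  · intro a b
    simp only [altSum_reflect_right, map_neg, neg_mul_neg]
  · intro a b
    simp only [altSum_add_diag _ _ hn h, altSum_add_diag _ _ hn h']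
  · intro a b
    simp only [altSum_add_three_mul _ _ hn]
  · intro b
    simp only [altSum_zero_left, zero_mul]
  · intro b
    simp only [altSum_zero_right, zero_mul]

/-! ### Dirichlet eigenfunctions on the triangle -/

theorem mem_triangleBoundary {n : ℕ} {k : Fin 3 → ℤ} : k ∈ triangleBoundary n ↔
    k ∈ triangle n ∧ (k 0 = 0 ∨ k 1 = 0 ∨ k 2 = -(n : ℤ)) := by
  rw [triangleBoundary, Finset.mem_filter]

theorem psi_eq_zero_of_mem_triangleBoundary {n : ℕ} (hn : n ≠ 0) {m k : Fin 3 → ℤ}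
    (hm : ∑ i, m i = 0) (hk : k ∈ triangleBoundary n) : psi m n k = 0 := by
  rw [mem_triangleBoundary, mem_triangle] at hk
  obtain ⟨⟨hs, -⟩, hb⟩ := hk
  rw [psi_eq_altSum n hs]
  rw [Fin.sum_univ_three] at hs hm
  rcases hb with h | h | h
  · rw [h, altSum_zero_left, mul_zero]
  · rw [h, altSum_zero_right, mul_zero]
  · have := altSum_reflect_diag (n := n) (p := m 0 - m 2) (r := m 1 - m 2) (k 0) (k 1) hn (by omega)
    rw [show (n : ℤ) - k 1 = k 0 by linarith, show (n : ℤ) - k 0 = k 1 by linarith] at this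
    rw [self_eq_neg.1 this, mul_zero]

theorem sum_psi_mul_conj {n : ℕ} (hn : n ≠ 0) {m m' : Fin 3 → ℤ} (hm : m ∈ triangleInterior n)
    (hm' : m' ∈ triangleInterior n) :
    ∑ k ∈ triangle n, psi m n k * (starRingEnd ℂ) (psi m' n k) = if m = m' then 1 else 0 := by
  rw [mem_triangleInterior] at hm hm'
  rw [sum_triangle_eq _ fun k hk => by
    rw [psi_eq_zero_of_mem_triangleBoundary hn hm.1 hk, zero_mul]]
  have e : ∀ k ∈ triangleInterior n, psi m n k * (starRingEnd ℂ) (psi m' n k) =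
      1 / (3 * (n : ℂ) ^ 2) * (altSum n (m 0 - m 2) (m 1 - m 2) (k 0) (k 1) *
        (starRingEnd ℂ) (altSum n (m' 0 - m' 2) (m' 1 - m' 2) (k 0) (k 1))) := by
    intro k hk
    rw [mem_triangleInterior] at hk
    have h3 : ((Real.sqrt 3 : ℝ) : ℂ) * (Real.sqrt 3 : ℝ) = 3 := by
      rw [← Complex.ofReal_mul, Real.mul_self_sqrt (by norm_num)]
      norm_num
    rw [psi_eq_altSum n hk.1, psi_eq_altSum n hk.1, map_mul]
    simp only [map_div₀, map_mul, map_one, Complex.conj_ofReal, Complex.conj_natCast]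
    rw [mul_mul_mul_comm, div_mul_div_comm, mul_mul_mul_comm _ (n : ℂ), h3, one_mul, pow_two]
  rw [Finset.sum_congr rfl e, ← Finset.mul_sum,
    sum_triangleInterior_eq (n := n) (fun a b => altSum n (m 0 - m 2) (m 1 - m 2) a b *
        (starRingEnd ℂ) (altSum n (m' 0 - m' 2) (m' 1 - m' 2) a b))]
  rw [Fin.sum_univ_three] at hm hm'
  -- Here 2p - r = 3 m 0, 2r - p = 3 m 1 and p + r = -3 m 2, so the inequalities say that m is
  -- interior.
  rw [sum_altSum_mul_conj hn (by omega) (by omega) (by omega) (by omega) (by omega) (by omega)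
    (by omega) (by omega)]
  have hn' : (n : ℂ) ≠ 0 := by exact_mod_cast hn
  by_cases hc : m = m'
  · subst hc
    simp only [and_self, if_true]
    field_simp
  · rw [if_neg, if_neg hc, mul_zero]
    rintro ⟨h1, h2⟩
    apply hc
    ext i
    fin_cases i <;> simp <;> omega

/-- Every character is an eigenfunction of the translation invariant operator, and the six steps of
the walk are permuted by the group, so the whole orbit shares one eigenvalue. No boundary enters:
the identity holds on all of A₂. -/
theorem latticeQ_psi (n : ℕ) (m : Fin 3 → ℤ) {k : Fin 3 → ℤ}
    (hk : ∑ i, k i = 0) :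
    latticeQ (psi m n) k = (eigenvalue m n : ℂ) * psi m n k := by
  have hcos : ∀ t : ℤ, ((Real.cos (2 * Real.pi * t / (3 * n)) : ℝ) : ℂ) =
      (rootChar n t + rootChar n (-t)) / 2 := by
    intro t
    rw [Complex.ofReal_cos, Complex.cos, rootChar, rootChar]
    push_cast
    ring_nf
  have hev : (eigenvalue m n : ℂ) = 1 / 6 *
      (rootChar n ((m 0 - m 2) - (m 1 - m 2)) + rootChar n ((m 1 - m 2) - (m 0 - m 2)) +
      rootChar n (m 1 - m 2) + rootChar n (-(m 1 - m 2)) +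
      rootChar n (m 0 - m 2) + rootChar n (-(m 0 - m 2))) := by
    have h1 := hcos (m 0 - m 1)
    have h2 := hcos (m 1 - m 2)
    have h3 := hcos (m 2 - m 0)
    push_cast at h1 h2 h3
    rw [eigenvalue]
    push_cast
    rw [h1, h2, h3, show (m 0 - m 2) - (m 1 - m 2) = m 0 - m 1 by ring,
      show (m 1 - m 2) - (m 0 - m 2) = -(m 0 - m 1) by ring,
      show -(m 0 - m 2) = m 2 - m 0 by ring, show m 0 - m 2 = -(m 2 - m 0) by ring]
    ring
  have hs : ∀ i j : Fin 3, ∑ l, (k + Pi.single i 1 - Pi.single j 1 : Fin 3 → ℤ) l = 0 := by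
    intro i j
    simp [Finset.sum_sub_distrib, Finset.sum_add_distrib, hk]
  have hsh : ∀ p r s t : ℤ, altSum n p r (k 0 + s) (k 1 + t) =
      rootChar n (p * k 0 + r * k 1) * rootChar n (p * s + r * t) +
      rootChar n (-r * k 0 + (p - r) * k 1) * rootChar n (-r * s + (p - r) * t) +
      rootChar n ((r - p) * k 0 + -p * k 1) * rootChar n ((r - p) * s + -p * t) -
      rootChar n (-r * k 0 + -p * k 1) * rootChar n (-r * s + -p * t) -
      rootChar n (p * k 0 + (p - r) * k 1) * rootChar n (p * s + (p - r) * t) -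
      rootChar n ((r - p) * k 0 + r * k 1) * rootChar n ((r - p) * s + r * t) := by
    intro p r s t
    simp only [← rootChar_add, altSum]
    ring_nf
  have u0 : (Finset.univ : Finset (Fin 3)).erase 0 = {1, 2} := by decide
  have u1 : (Finset.univ : Finset (Fin 3)).erase 1 = {0, 2} := by decide
  have u2 : (Finset.univ : Finset (Fin 3)).erase 2 = {0, 1} := by decide
  have step : ∀ (i j : Fin 3) (s t : ℤ), (Pi.single i 1 - Pi.single j 1 : Fin 3 → ℤ) 0 = s →
      (Pi.single i 1 - Pi.single j 1 : Fin 3 → ℤ) 1 = t →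
      psi m n (k + Pi.single i 1 - Pi.single j 1) = 1 / ((Real.sqrt 3 : ℂ) * n) *
        altSum n (m 0 - m 2) (m 1 - m 2) (k 0 + s) (k 1 + t) := by
    rintro i j s t rfl rfl
    rw [psi_eq_altSum n (hs i j)]
    simp only [Pi.add_apply, Pi.sub_apply, add_sub_assoc]
  have hQ : latticeQ (psi m n) k = 1 / 6 * (
      (psi m n (k + Pi.single 0 1 - Pi.single 1 1) + psi m n (k + Pi.single 0 1 - Pi.single 2 1)) +
      (psi m n (k + Pi.single 1 1 - Pi.single 0 1) + psi m n (k + Pi.single 1 1 - Pi.single 2 1)) +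
      (psi m n (k + Pi.single 2 1 - Pi.single 0 1) +
        psi m n (k + Pi.single 2 1 - Pi.single 1 1))) := by
    rw [latticeQ, Fin.sum_univ_three, u0, u1, u2, Finset.sum_pair (by decide),
      Finset.sum_pair (by decide), Finset.sum_pair (by decide)]
  rw [hQ, step 0 1 1 (-1) (by simp) (by simp), step 0 2 1 0 (by simp) (by simp),
    step 1 0 (-1) 1 (by simp) (by simp), step 1 2 0 1 (by simp) (by simp),
    step 2 0 (-1) 0 (by simp) (by simp), step 2 1 0 (-1) (by simp) (by simp),
    psi_eq_altSum n hk, hev]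
  simp only [hsh]
  simp only [altSum, mul_one, mul_zero, add_zero, zero_add, mul_neg]
  generalize m 0 - m 2 = p
  generalize m 1 - m 2 = r
  ring_nf

theorem dirichletQ_psi {n : ℕ} (hn : n ≠ 0) {m k : Fin 3 → ℤ} (hm : ∑ i, m i = 0)
    (hk : k ∈ triangle n) :
    dirichletQ n (psi m n) k = (eigenvalue m n : ℂ) * psi m n k := by
  rw [dirichletQ]
  split_ifs with h
  · exact latticeQ_psi n m (mem_triangle.1 hk).1
  · rw [psi_eq_zero_of_mem_triangleBoundary hn hm, mul_zero]
    by_contra hb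
    exact h (Finset.mem_sdiff.2 ⟨hk, hb⟩)

/-- The `ψ_{m,n}` form a basis of the functions on the interior of the triangle. -/
theorem sum_conj_psi_mul_psi {n : ℕ} (hn : n ≠ 0) {k l : Fin 3 → ℤ} (hk : k ∈ triangleInterior n)
    (hl : l ∈ triangleInterior n) :
    ∑ m ∈ triangleInterior n, (starRingEnd ℂ) (psi m n k) * psi m n l =
      if k = l then 1 else 0 := by
  let A : Matrix (triangleInterior n) (triangleInterior n) ℂ := fun m k => psi m n k
  have h : A * A.conjTranspose = 1 := by
    ext m m'
    rw [Matrix.mul_apply, Matrix.one_apply]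
    have := sum_psi_mul_conj hn m.2 m'.2
    rw [sum_triangle_eq _ fun k hk => by
      rw [psi_eq_zero_of_mem_triangleBoundary hn (mem_triangleInterior.1 m.2).1 hk, zero_mul],
      ← Finset.sum_coe_sort] at this
    simp only [A]
    simp only [Subtype.ext_iff]
    exact this
  -- The index m and the argument k range over the same finite set, so `A` is square and orthonormal
  -- rows force orthonormal columns.
  have h2 : A.conjTranspose * A = 1 := mul_eq_one_comm.1 h
  have h' := congrFun (congrFun h2 ⟨k, hk⟩) ⟨l, hl⟩
  rw [Matrix.mul_apply, Matrix.one_apply] at h'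
  simp only [A, Subtype.mk.injEq] at h'
  rw [← h', ← Finset.sum_coe_sort]
  rfl

/-! ### Symmetric operators with a total set of eigenvectors -/

section Spectral

variable {E : Type*} [NormedAddCommGroup E] [InnerProductSpace ℂ E]

/-- The sum of the eigenspaces of `T` for the eigenvalues in `S`. -/
def eigenspaceSum (T : E →L[ℂ] E) (S : Set ℂ) : Submodule ℂ E :=
  ⨆ z : S, Module.End.eigenspace T.toLinearMap (z : ℂ)

variable {T : E →L[ℂ] E} {S : Set ℂ}

theorem mem_eigenspaceSum {z : ℂ} (hz : z ∈ S) {v : E} (hv : T v = z • v) :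
    v ∈ eigenspaceSum T S :=
  Submodule.mem_iSup_of_mem ⟨z, hz⟩ (Module.End.mem_eigenspace_iff.2 hv)

/-- Eigenspaces of a symmetric operator are orthogonal, so by Pythagoras the bound may be checked on
each component, where T - w is multiplication by z - w. -/
theorem norm_sub_smul_ge_of_mem_eigenspaceSum (hT : T.toLinearMap.IsSymmetric) {w : ℂ} {δ : ℝ}
    (hδ0 : 0 ≤ δ) (hδ : ∀ z ∈ S, δ ≤ ‖z - w‖) {v : E} (hv : v ∈ eigenspaceSum T S) :
    δ * ‖v‖ ≤ ‖T v - w • v‖ := by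
  classical
  obtain ⟨f, rfl⟩ := (Submodule.mem_iSup_iff_exists_dfinsupp' _ _).1 hv
  have hO := hT.orthogonalFamily_eigenspaces.comp (γ := S) Subtype.coe_injective
  have e1 : (f.sum fun _ x => (x : E)) = ∑ z ∈ f.support,
      (Module.End.eigenspace T.toLinearMap (z : ℂ)).subtypeₗᵢ (f z) := rfl
  have e2 : T (f.sum fun _ x => (x : E)) - w • (f.sum fun _ x => (x : E)) = ∑ z ∈ f.support,
      (Module.End.eigenspace T.toLinearMap (z : ℂ)).subtypeₗᵢ (((z : ℂ) - w) • f z) := by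
    rw [DFinsupp.sum, map_sum, Finset.smul_sum, ← Finset.sum_sub_distrib]
    refine Finset.sum_congr rfl fun z _ => ?_
    have := Module.End.mem_eigenspace_iff.1 (f z).2
    simp only [ContinuousLinearMap.coe_coe] at this
    simp [this, sub_smul]
  rw [e2, e1]
  have n1 := hO.norm_sum (fun z => f z) f.support
  have n2 := hO.norm_sum (fun z => ((z : ℂ) - w) • f z) f.support
  refine le_of_sq_le_sq ?_ (norm_nonneg _)
  rw [mul_pow]
  erw [n1, n2]
  rw [Finset.mul_sum]
  refine Finset.sum_le_sum fun z _ => ?_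
  rw [norm_smul, mul_pow]
  gcongr
  exact hδ z z.2

/-- An eigenvector for a value outside S would be orthogonal to a dense subspace, hence to itself.
-/
theorem eigenvalue_mem_of_dense (hT : T.toLinearMap.IsSymmetric)
    (hS : (eigenspaceSum T S).topologicalClosure = ⊤) {w : ℂ}
    (hw : Module.End.HasEigenvalue T.toLinearMap w) : w ∈ S := by
  by_contra hn
  obtain ⟨v, hv, hv0⟩ := hw.exists_hasEigenvector
  apply hv0
  have hle : eigenspaceSum T S ≤ (ℂ ∙ v)ᗮ := by
    refine iSup_le fun z => fun u hu => ?_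
    rw [Submodule.mem_orthogonal_singleton_iff_inner_right]
    have hne : w ≠ z := fun h => hn (h ▸ z.2)
    exact hT.orthogonalFamily_eigenspaces hne ⟨v, hv⟩ ⟨u, hu⟩
  have hle' := (eigenspaceSum T S).topologicalClosure_minimal hle
    (Submodule.isClosed_orthogonal _)
  rw [hS, top_le_iff] at hle'
  have : v ∈ (ℂ ∙ v)ᗮ := hle' ▸ Submodule.mem_top
  rw [Submodule.mem_orthogonal_singleton_iff_inner_right] at this
  exact inner_self_eq_zero.1 this

/-- At positive distance from S, T - w is bounded below on a dense subspace, hence everywhere by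
continuity; its range contains every eigenvector for S and so is dense. In a complete space this
gives invertibility. -/
theorem spectrum_subset_closure_of_dense [CompleteSpace E] (hT : T.toLinearMap.IsSymmetric)
    (hS : (eigenspaceSum T S).topologicalClosure = ⊤) : spectrum ℂ T ⊆ closure S := by
  intro w hw
  by_contra hn
  apply hw
  obtain ⟨δ, hδ, hball⟩ := Metric.isOpen_iff.1 isClosed_closure.isOpen_compl w hn
  have hdist : ∀ z ∈ S, δ ≤ ‖z - w‖ := by
    intro z hz
    by_contra h
    exact hball (by rwa [Metric.mem_ball, dist_eq_norm, ← not_le]) (subset_closure hz)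
  have hdense : Dense (eigenspaceSum T S : Set E) :=
    (eigenspaceSum T S).dense_iff_topologicalClosure_eq_top.2 hS
  have hbound : ∀ v, δ * ‖v‖ ≤ ‖T v - w • v‖ := by
    intro v
    refine hdense.induction (P := fun v => δ * ‖v‖ ≤ ‖T v - w • v‖)
      (fun v hv => norm_sub_smul_ge_of_mem_eigenspaceSum hT hδ.le hdist hv) ?_ v
    exact isClosed_le (by fun_prop) (by fun_prop)
  have hap : ∀ v, (T - algebraMap ℂ (E →L[ℂ] E) w) v = T v - w • v := by
    intro v
    simp [Algebra.algebraMap_eq_smul_one]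
  have hunit : IsUnit (T - algebraMap ℂ (E →L[ℂ] E) w) := by
    rw [ContinuousLinearMap.isUnit_iff_bijective,
      ContinuousLinearMap.bijective_iff_dense_range_and_antilipschitz]
    constructor
    · rw [← top_le_iff, ← hS]
      refine Submodule.topologicalClosure_mono (iSup_le fun z v hv => ?_)
      have hv' := Module.End.mem_eigenspace_iff.1 hv
      simp only [ContinuousLinearMap.coe_coe] at hv'
      have hne : (z : ℂ) - w ≠ 0 := by
        have := hδ.trans_le (hdist z z.2)
        exact norm_pos_iff.1 this
      refine ⟨((z : ℂ) - w)⁻¹ • v, ?_⟩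
      rw [ContinuousLinearMap.coe_coe, map_smul, hap, hv', ← sub_smul, smul_smul,
        inv_mul_cancel₀ hne, one_smul]
    · refine ⟨⟨δ⁻¹, by positivity⟩, ?_⟩
      refine AddMonoidHomClass.antilipschitz_of_bound _ fun v => ?_
      change ‖v‖ ≤ δ⁻¹ * _
      rw [hap, inv_mul_eq_div, le_div_iff₀ hδ, mul_comm]
      exact hbound v
  rw [spectrum.mem_resolventSet_iff, ← neg_sub]
  exact hunit.neg

theorem spectrum_eq_closure_of_dense [CompleteSpace E] (hT : T.toLinearMap.IsSymmetric)
    (hS : (eigenspaceSum T S).topologicalClosure = ⊤)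
    (hS' : ∀ z ∈ S, Module.End.HasEigenvalue T.toLinearMap z) : spectrum ℂ T = closure S := by
  refine (spectrum_subset_closure_of_dense hT hS).antisymm ?_
  refine closure_minimal (fun z hz => ?_) (spectrum.isClosed T)
  intro hu
  obtain ⟨v, hv, hv0⟩ := (hS' z hz).exists_hasEigenvector
  have hv' := Module.End.mem_eigenspace_iff.1 hv
  simp only [ContinuousLinearMap.coe_coe] at hv'
  rw [spectrum.mem_resolventSet_iff, ContinuousLinearMap.isUnit_iff_bijective] at hu
  apply hv0
  apply hu.1
  simp [Algebra.algebraMap_eq_smul_one, hv']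

end Spectral

section SRW

variable {V : Type*} {G : SimpleGraph V} [G.LocallyFinite]

/-- The simple random walk operator on a regular graph is symmetric. -/
theorem srw_isSymmetric {D d : ℕ} (hD : ∀ x, G.degree x ≤ D) (hreg : G.IsRegularOfDegree d) :
    (srw G hD).toLinearMap.IsSymmetric := by
  classical
  -- The adjoint is evaluated at x by pairing with the image of the point mass at x; regularity
  -- gives that image the same weight 1/d at every neighbour.
  have hadj : ContinuousLinearMap.adjoint (srw G hD) = srw G hD := by
    ext f x
    have h1 : ContinuousLinearMap.adjoint (srw G hD) f x =
        inner ℂ (srw G hD (lp.single 2 x (1 : ℂ))) f := by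
      rw [← ContinuousLinearMap.adjoint_inner_right, lp.inner_single_left]
      simp
    have h2 : srw G hD (lp.single 2 x (1 : ℂ)) =
        ∑ y ∈ G.neighborFinset x, lp.single 2 y (1 / (d : ℂ)) := by
      ext y
      rw [srw_apply, hreg y, lp.coeFn_sum, Finset.sum_apply]
      simp only [lp.single_apply, SimpleGraph.mem_neighborFinset,
        Pi.single_apply, Finset.sum_ite_eq', Finset.sum_ite_eq, G.adj_comm y x]
      simp
    rw [h1, h2, sum_inner, srw_apply, hreg x, Finset.mul_sum]
    refine Finset.sum_congr rfl fun y _ => ?_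
    rw [lp.inner_single_left]
    simp [mul_comm]
  intro f g
  rw [ContinuousLinearMap.coe_coe, ← ContinuousLinearMap.adjoint_inner_left, hadj]

end SRW

/-! ### Horocyclic subtrees -/

namespace TreeVertex

variable {q : ℕ}

/-- `v` lies on the geodesic from `z` to the end `ω`. -/
def Below (v z : TreeVertex q) : Prop := ∃ j : ℕ, pred^[j] z = v

theorem level_iterate_pred (j : ℕ) (z : TreeVertex q) : (pred^[j] z).level = z.level - j := by
  induction j with
  | zero => simp
  | succ j ih =>
    rw [Function.iterate_succ_apply', level_pred, ih]
    push_cast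
    ring

theorem below_refl (v : TreeVertex q) : Below v v := ⟨0, rfl⟩

theorem below_iff {v z : TreeVertex q} : Below v z ↔ z = v ∨ Below v z.pred := by
  constructor
  · rintro ⟨_ | j, h⟩
    · exact Or.inl h
    · exact Or.inr ⟨j, h⟩
  · rintro (rfl | ⟨j, h⟩)
    · exact below_refl z
    · exact ⟨j + 1, h⟩

theorem below_succ_iff {v z : TreeVertex q} {l : ZMod q} :
    Below v (z.succ l) ↔ z.succ l = v ∨ Below v z := by
  rw [below_iff, pred_succ]

theorem Below.pred_left {v z : TreeVertex q} (h : Below v z) : Below v.pred z := by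
  obtain ⟨j, rfl⟩ := h
  exact ⟨j + 1, Function.iterate_succ_apply' _ _ _⟩

theorem below_iff_eq {v z : TreeVertex q} (h : z.level ≤ v.level) : Below v z ↔ z = v := by
  constructor
  · rintro ⟨_ | j, rfl⟩
    · rfl
    · rw [level_iterate_pred] at h
      push_cast at h
      omega
  · rintro rfl
    exact below_refl z

theorem iterate_pred_eq_iff {x z : TreeVertex q} (h : z.level = x.level) (j : ℕ) :
    pred^[j] z = pred^[j] x ↔ Below (pred^[j] x) z := by
  constructor
  · exact fun h => ⟨j, h⟩
  · rintro ⟨i, hi⟩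
    have := congrArg level hi
    rw [level_iterate_pred, level_iterate_pred] at this
    obtain rfl : i = j := by omega
    exact hi

open Classical in
/-- The difference of the indicator function of the subtree below `v` and of `1/q` times the
indicator function of the subtree below the predecessor of `v`. -/
noncomputable def haar (v z : TreeVertex q) : ℂ :=
  (if Below v z then 1 else 0) - (1 / q) * (if Below v.pred z then 1 else 0)

theorem haar_congr {v z z' : TreeVertex q} (h1 : Below v z ↔ Below v z')
    (h2 : Below v.pred z ↔ Below v.pred z') : haar v z = haar v z' := by
  classical
  unfold haar
  congr 1
  · exact if_congr h1 rfl rfl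
  · congr 1
    exact if_congr h2 rfl rfl

/-- From the level of v onwards, neither v nor its predecessor can be a newly created vertex, so
both indicators are inherited from the parent. -/
theorem haar_succ {v z : TreeVertex q} (h : v.level ≤ z.level) (l : ZMod q) :
    haar v (z.succ l) = haar v z := by
  have h1 : z.succ l ≠ v := by
    rintro rfl
    simp at h
  have h2 : z.succ l ≠ v.pred := by
    intro h2
    have := congrArg level h2
    simp only [level_succ, level_pred] at this
    omega
  exact haar_congr (below_succ_iff.trans (or_iff_right h1)) (below_succ_iff.trans (or_iff_right h2))

theorem haar_pred {v z : TreeVertex q} (h : v.level < z.level) : haar v z.pred = haar v z := by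
  conv_rhs => rw [← succ_pred z]
  rw [haar_succ]
  rw [level_pred]
  omega

theorem haar_of_not_below {v z : TreeVertex q} (h : ¬ Below v.pred z) : haar v z = 0 := by
  rw [haar, if_neg h, if_neg (mt Below.pred_left h)]
  simp

theorem haar_of_below {v z : TreeVertex q} (h : Below v z) : haar v z = 1 - 1 / q := by
  rw [haar, if_pos h, if_pos h.pred_left, mul_one]

/-- If z is the predecessor of v, one successor is v and all q lie below z, giving 1 - q · (1/q);
otherwise both indicators vanish. This mean-zero property supplies the boundary condition from
outside the triangle. -/
theorem sum_haar_succ [NeZero q] {v z : TreeVertex q} (h : z.level + 1 = v.level) :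
    ∑ l, haar v (z.succ l) = 0 := by
  classical
  have hq : (q : ℂ) ≠ 0 := Nat.cast_ne_zero.2 (NeZero.ne q)
  have h1 : ∀ l, Below v (z.succ l) ↔ z.succ l = v := fun l =>
    below_iff_eq (by rw [level_succ, h])
  have h2 : ∀ l, Below v.pred (z.succ l) ↔ z = v.pred := fun l => by
    rw [below_succ_iff, below_iff_eq (by rw [level_pred]; omega), or_iff_right]
    intro h2
    have := congrArg level h2
    simp only [level_succ, level_pred] at this
    omega
  have e : ∀ l, haar v (z.succ l) =
      (if z.succ l = v then 1 else 0) - 1 / q * (if z = v.pred then 1 else 0) := by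
    intro l
    unfold haar
    congr 1
    · exact if_congr (h1 l) rfl rfl
    · congr 1
      exact if_congr (h2 l) rfl rfl
  simp only [e, Finset.sum_sub_distrib, Finset.sum_const, Finset.card_univ, ZMod.card]
  by_cases hz : z = v.pred
  · have h3 : ∀ l, z.succ l = v ↔ v.label v.level = l := fun l => by
      rw [hz]
      nth_rewrite 2 [← succ_pred v]
      rw [(succ_injective _).eq_iff, eq_comm]
    simp only [h3]
    rw [Finset.sum_ite_eq, if_pos (Finset.mem_univ _), if_pos hz, nsmul_eq_mul]
    field_simp
    simp
  · have h3 : ∀ l, z.succ l ≠ v := fun l h => hz (by rw [← h, pred_succ])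
    simp [h3, hz]

open Classical in
/-- The vertices `j` generations below `y`. -/
noncomputable def descendants [NeZero q] : ℕ → TreeVertex q → Finset (TreeVertex q)
  | 0, y => {y}
  | j + 1, y => Finset.univ.biUnion fun l => descendants j (y.succ l)

theorem mem_descendants [NeZero q] {j : ℕ} {y z : TreeVertex q} :
    z ∈ descendants j y ↔ pred^[j] z = y := by
  induction j generalizing y with
  | zero => simp [descendants]
  | succ j ih =>
    rw [Function.iterate_succ_apply', pred_eq_iff]
    simp only [descendants, Finset.mem_biUnion, Finset.mem_univ, true_and, ih, eq_comm]

theorem card_descendants_le [NeZero q] (j : ℕ) (y : TreeVertex q) :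
    (descendants j y).card ≤ q ^ j := by
  classical
  induction j generalizing y with
  | zero => simp [descendants]
  | succ j ih =>
    refine Finset.card_biUnion_le.trans ((Finset.sum_le_card_nsmul _ _ _ fun l _ => ih _).trans ?_)
    simp [ZMod.card, pow_succ']

end TreeVertex

open TreeVertex

/-! ### Finitely supported elements of `ℓ²` -/

section FiniteSupport

variable {V : Type*}

open Classical in
/-- The restriction of `f` to the finite set `s`, as an element of `ℓ²`. -/
noncomputable def restrictLp (s : Finset V) (f : V → ℂ) : lp (fun _ : V => ℂ) 2 :=
  ∑ x ∈ s, lp.single 2 x (f x)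

theorem restrictLp_apply {s : Finset V} {f : V → ℂ} {y : V} (h : y ∉ s → f y = 0) :
    restrictLp s f y = f y := by
  classical
  rw [restrictLp, lp.coeFn_sum, Finset.sum_apply]
  simp only [lp.single_apply, Pi.single_apply, Finset.sum_ite_eq]
  split_ifs with hy
  · rfl
  · exact (h hy).symm

theorem norm_restrictLp_sq (s : Finset V) (f : V → ℂ) :
    ‖restrictLp s f‖ ^ 2 = ∑ x ∈ s, ‖f x‖ ^ 2 := by
  classical
  have := lp.norm_sum_single (p := 2) (by norm_num) f s
  simp only [ENNReal.toReal_ofNat, Real.rpow_ofNat] at this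
  exact this

end FiniteSupport

/-- The vertices of the Diestel-Leader graph with coordinates in given finite sets. -/
noncomputable def dlBox {q : ℕ} (s : Fin 3 → Finset (TreeVertex q)) :
    Finset (DLVertex (fun _ : Fin 3 => q)) :=
  (Fintype.piFinset s).preimage (fun x => x.1) (Subtype.val_injective.injOn)

theorem mem_dlBox {q : ℕ} {s : Fin 3 → Finset (TreeVertex q)}
    {x : DLVertex (fun _ : Fin 3 => q)} : x ∈ dlBox s ↔ ∀ i, x.1 i ∈ s i := by
  exact Finset.mem_preimage.trans Fintype.mem_piFinset

theorem card_dlBox_le {q : ℕ} (s : Fin 3 → Finset (TreeVertex q)) :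
    (dlBox s).card ≤ ∏ i, (s i).card := by
  rw [← Fintype.card_piFinset]
  refine Finset.card_le_card_of_injOn (fun x => x.1) (fun x hx => ?_) (Subtype.val_injective.injOn)
  exact Finset.mem_preimage.1 hx

/-! ### The walk on the Diestel-Leader graph -/

section Walk

variable {q : ℕ}

theorem neighbor_apply_succ (x : DLVertex (fun _ : Fin 3 => q)) (p : {p : Fin 3 × Fin 3 // p.1 ≠ p.2})
    (l : ZMod q) : (DL.neighbor x ⟨p, l⟩).1 p.1.2 = (x.1 p.1.2).succ l := by
  simp [DL.neighbor]

theorem neighbor_apply_pred (x : DLVertex (fun _ : Fin 3 => q)) (p : {p : Fin 3 × Fin 3 // p.1 ≠ p.2})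
    (l : ZMod q) : (DL.neighbor x ⟨p, l⟩).1 p.1.1 = (x.1 p.1.1).pred := by
  simp [DL.neighbor, Function.update_of_ne p.2]

theorem neighbor_apply_of_ne (x : DLVertex (fun _ : Fin 3 => q))
    (p : {p : Fin 3 × Fin 3 // p.1 ≠ p.2}) (l : ZMod q) {k : Fin 3} (h1 : k ≠ p.1.1)
    (h2 : k ≠ p.1.2) : (DL.neighbor x ⟨p, l⟩).1 k = x.1 k := by
  simp [DL.neighbor, Function.update_of_ne h1, Function.update_of_ne h2]

theorem srwDL3_apply [NeZero q] (f : lp (fun _ : DLVertex (fun _ : Fin 3 => q) => ℂ) 2)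
    (x : DLVertex (fun _ : Fin 3 => q)) : srwDL3 q f x =
      1 / (6 * q) * ∑ p : {p : Fin 3 × Fin 3 // p.1 ≠ p.2}, ∑ l : ZMod q,
        f (DL.neighbor x ⟨p, l⟩) := by
  rw [srwDL3, srw_apply, DL.isRegularOfDegree (fun _ : Fin 3 => q) x]
  congr 1
  · simp
    ring
  · rw [← Fintype.sum_sigma']
    refine (Finset.sum_bij (fun p _ => DL.neighbor x p) ?_ ?_ ?_ ?_).symm
    · intro p _
      rw [SimpleGraph.mem_neighborFinset, ← SimpleGraph.mem_neighborSet, ← DL.range_neighbor]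
      exact ⟨p, rfl⟩
    · exact fun p _ p' _ h => DL.neighbor_injective x h
    · intro y hy
      rw [SimpleGraph.mem_neighborFinset, ← SimpleGraph.mem_neighborSet, ← DL.range_neighbor] at hy
      obtain ⟨p, hp⟩ := hy
      exact ⟨p, Finset.mem_univ _, hp⟩
    · intro p _
      rfl

theorem sum_ne_pairs (g : Fin 3 → Fin 3 → ℂ) :
    ∑ p : {p : Fin 3 × Fin 3 // p.1 ≠ p.2}, g p.1.1 p.1.2 =
      ∑ i, ∑ j ∈ Finset.univ.erase i, g j i := by
  rw [← Finset.sum_subtype (p := fun p : Fin 3 × Fin 3 => p.1 ≠ p.2)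
    (Finset.univ.filter fun p : Fin 3 × Fin 3 => p.1 ≠ p.2) (by simp) (fun p => g p.1 p.2),
    Finset.sum_filter, Fintype.sum_prod_type, Finset.sum_comm]
  refine Finset.sum_congr rfl fun i _ => ?_
  rw [← Finset.sum_filter, ← Finset.filter_ne']

/-- The position of the levels of `z` relative to the triangle attached to `v`. -/
def triangleCoord (v : Fin 3 → TreeVertex q) (z : DLVertex (fun _ : Fin 3 => q)) : Fin 3 → ℤ :=
  ![(z.1 0).level - (v 0).level + 1, (z.1 1).level - (v 1).level + 1,
    (z.1 2).level + (v 0).level + (v 1).level - 2]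

theorem sum_level (z : DLVertex (fun _ : Fin 3 => q)) :
    (z.1 0).level + (z.1 1).level + (z.1 2).level = 0 := by
  have := z.2
  rwa [Fin.sum_univ_three] at this

theorem sum_triangleCoord (v : Fin 3 → TreeVertex q) (z : DLVertex (fun _ : Fin 3 => q)) :
    ∑ i, triangleCoord v z i = 0 := by
  have := sum_level z
  simp only [Fin.sum_univ_three, triangleCoord, Matrix.cons_val]
  linarith

variable {n : ℕ} {v : Fin 3 → TreeVertex q}

/-- The offset 1 turns strict positivity into level at least that of v i. In the third coordinate,
the sum 3 - n of the levels of v makes the bound > -n say the same. -/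
theorem triangleCoord_mem_interior (hv : ∑ i, (v i).level = 3 - n)
    {z : DLVertex (fun _ : Fin 3 => q)} :
    triangleCoord v z ∈ triangleInterior n ↔ ∀ i, (v i).level ≤ (z.1 i).level := by
  rw [mem_triangleInterior, and_iff_right (sum_triangleCoord v z)]
  rw [Fin.sum_univ_three] at hv
  simp only [triangleCoord, Matrix.cons_val, Fin.forall_fin_succ, Fin.succ_zero_eq_one,
    Fin.succ_one_eq_two, IsEmpty.forall_iff, and_true]
  omega

theorem triangleCoord_neighbor (x : DLVertex (fun _ : Fin 3 => q))
    (p : {p : Fin 3 × Fin 3 // p.1 ≠ p.2}) (l : ZMod q) :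
    triangleCoord v (DL.neighbor x ⟨p, l⟩) =
      triangleCoord v x + Pi.single p.1.2 1 - Pi.single p.1.1 1 := by
  have hl : ∀ k, ((DL.neighbor x ⟨p, l⟩).1 k).level = (x.1 k).level +
      (Pi.single p.1.2 1 - Pi.single p.1.1 1 : Fin 3 → ℤ) k := by
    intro k
    by_cases h2 : k = p.1.2
    · subst h2
      rw [neighbor_apply_succ, level_succ]
      simp [Pi.single_eq_of_ne p.2.symm]
    · by_cases h1 : k = p.1.1
      · subst h1
        rw [neighbor_apply_pred, level_pred]
        simp [Pi.single_eq_of_ne h2]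
        ring
      · rw [neighbor_apply_of_ne x p l h1 h2]
        simp [h1, h2]
  ext k
  rw [add_sub_assoc, Pi.add_apply]
  fin_cases k <;> simp [triangleCoord, hl] <;> ring

open Classical in
/-- The function on the Diestel-Leader graph given by the function `c` of the levels on the triangle
attached to `v` and the functions `haar (v i)`. -/
noncomputable def tetra (n : ℕ) (v : Fin 3 → TreeVertex q) (c : (Fin 3 → ℤ) → ℂ)
    (z : DLVertex (fun _ : Fin 3 => q)) : ℂ :=
  if triangleCoord v z ∈ triangleInterior n then
    c (triangleCoord v z) * ∏ i, haar (v i) (z.1 i) else 0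

theorem prod_haar_neighbor (x : DLVertex (fun _ : Fin 3 => q))
    (p : {p : Fin 3 × Fin 3 // p.1 ≠ p.2}) (l : ZMod q) :
    ∏ i, haar (v i) ((DL.neighbor x ⟨p, l⟩).1 i) = haar (v p.1.2) ((x.1 p.1.2).succ l) *
      (haar (v p.1.1) (x.1 p.1.1).pred *
        ∏ i ∈ (Finset.univ.erase p.1.2).erase p.1.1, haar (v i) (x.1 i)) := by
  rw [← Finset.mul_prod_erase _ _ (Finset.mem_univ p.1.2), neighbor_apply_succ,
    ← Finset.mul_prod_erase _ _ (Finset.mem_erase.2 ⟨p.2, Finset.mem_univ p.1.1⟩),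
    neighbor_apply_pred]
  congr 2
  refine Finset.prod_congr rfl fun k hk => ?_
  simp only [Finset.mem_erase] at hk
  rw [neighbor_apply_of_ne x p l hk.1 hk.2.1]

/-- Inside the triangle a step either stays inside, leaving every `haar` factor unchanged, or lands
on the boundary, where c is 0. A step from outside into the triangle must raise a coordinate from
one level too low, and the sum over its q successors cancels. -/
theorem sum_tetra_neighbor [NeZero q] (hv : ∑ i, (v i).level = 3 - n) {c : (Fin 3 → ℤ) → ℂ}
    (hc : ∀ k ∈ triangleBoundary n, c k = 0) (x : DLVertex (fun _ : Fin 3 => q))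
    (p : {p : Fin 3 × Fin 3 // p.1 ≠ p.2}) :
    ∑ l, tetra n v c (DL.neighbor x ⟨p, l⟩) =
      q * tetra n v (fun k => c (k + Pi.single p.1.2 1 - Pi.single p.1.1 1)) x := by
  have hlev : ∀ l, ((DL.neighbor x ⟨p, l⟩).1 p.1.1).level = (x.1 p.1.1).level - 1 := fun l => by
    rw [neighbor_apply_pred, level_pred]
  have hlev' : ∀ l, ((DL.neighbor x ⟨p, l⟩).1 p.1.2).level = (x.1 p.1.2).level + 1 := fun l => by
    rw [neighbor_apply_succ, level_succ]
  by_cases hx : triangleCoord v x ∈ triangleInterior n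
  · have hx' := (triangleCoord_mem_interior hv).1 hx
    have e : ∀ l, tetra n v c (DL.neighbor x ⟨p, l⟩) =
        tetra n v (fun k => c (k + Pi.single p.1.2 1 - Pi.single p.1.1 1)) x := by
      intro l
      rw [tetra, tetra, if_pos hx]
      split_ifs with hy
      · rw [triangleCoord_neighbor, prod_haar_neighbor, haar_succ (hx' _), haar_pred,
          Finset.mul_prod_erase _ (fun i => haar (v i) (x.1 i))
            (Finset.mem_erase.2 ⟨p.2, Finset.mem_univ p.1.1⟩),
          Finset.mul_prod_erase _ (fun i => haar (v i) (x.1 i)) (Finset.mem_univ p.1.2)]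
        have := (triangleCoord_mem_interior hv).1 hy p.1.1
        rw [hlev] at this
        omega
      -- One step lowers no coordinate by more than one, so leaving the interior means landing on
      -- the boundary.
      · rw [hc, zero_mul]
        rw [triangleCoord_neighbor] at hy
        by_contra hb
        apply hy
        refine Finset.mem_sdiff.2 ⟨?_, hb⟩
        have hs := sum_triangleCoord v (DL.neighbor x ⟨p, l⟩)
        rw [triangleCoord_neighbor] at hs
        rw [mem_triangle]
        refine ⟨hs, ?_⟩
        rw [mem_triangleInterior] at hx
        have hle : ∀ k, triangleCoord v x k - 1 ≤
            (triangleCoord v x + Pi.single p.1.2 1 - Pi.single p.1.1 1 : Fin 3 → ℤ) k := by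
          intro k
          simp only [Pi.add_apply, Pi.sub_apply, Pi.single_apply]
          split_ifs <;> omega
        have h0 := hle 0
        have h1 := hle 1
        have h2 := hle 2
        omega
    rw [Finset.sum_congr rfl fun l _ => e l, Finset.sum_const, Finset.card_univ, ZMod.card,
      nsmul_eq_mul]
  · rw [tetra, if_neg hx, mul_zero]
    rw [triangleCoord_mem_interior hv] at hx
    push Not at hx
    obtain ⟨k, hk⟩ := hx
    by_cases hy : ∀ i, (v i).level ≤ ((DL.neighbor x ⟨p, 0⟩).1 i).level
    -- A coordinate that is too low before the step and admissible after it can only be the one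
    -- moved to a successor.
    · have hkj : k = p.1.2 := by
        by_contra h2
        have := hy k
        by_cases h1 : k = p.1.1
        · subst h1
          rw [hlev] at this
          omega
        · rw [neighbor_apply_of_ne x p 0 h1 h2] at this
          omega
      subst hkj
      have := hy p.1.2
      rw [hlev'] at this
      have e : ∀ l, tetra n v c (DL.neighbor x ⟨p, l⟩) = haar (v p.1.2) ((x.1 p.1.2).succ l) *
          (c (triangleCoord v x + Pi.single p.1.2 1 - Pi.single p.1.1 1) *
          (haar (v p.1.1) (x.1 p.1.1).pred *
        ∏ i ∈ (Finset.univ.erase p.1.2).erase p.1.1, haar (v i) (x.1 i))) := by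
        intro l
        rw [tetra, triangleCoord_neighbor, if_pos, prod_haar_neighbor]
        · ring
        · rw [← triangleCoord_neighbor x p 0]
          exact (triangleCoord_mem_interior hv).2 hy
      rw [Finset.sum_congr rfl fun l _ => e l, ← Finset.sum_mul, sum_haar_succ (by omega), zero_mul]
    · refine Finset.sum_eq_zero fun l _ => ?_
      rw [tetra, if_neg]
      rwa [triangleCoord_neighbor, ← triangleCoord_neighbor x p 0, triangleCoord_mem_interior hv]

/-- A finite set containing the support of `tetra n v c`. -/
noncomputable def tetraSupport [NeZero q] (n : ℕ) (v : Fin 3 → TreeVertex q) :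
    Finset (DLVertex (fun _ : Fin 3 => q)) := by
  classical
  exact dlBox fun i => (Finset.range (n + 1)).biUnion fun j => descendants j (v i).pred

theorem tetra_eq_zero [NeZero q] (hv : ∑ i, (v i).level = 3 - n) {c : (Fin 3 → ℤ) → ℂ}
    {z : DLVertex (fun _ : Fin 3 => q)} (hz : z ∉ tetraSupport n v) : tetra n v c z = 0 := by
  classical
  rw [tetra]
  split_ifs with h
  swap
  · rfl
  rw [tetraSupport, mem_dlBox] at hz
  push Not at hz
  obtain ⟨i, hi⟩ := hz
  rw [Finset.prod_eq_zero (Finset.mem_univ i), mul_zero]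
  apply haar_of_not_below
  rintro ⟨j, hj⟩
  apply hi
  rw [Finset.mem_biUnion]
  refine ⟨j, ?_, mem_descendants.2 hj⟩
  have h1 := congrArg level hj
  rw [level_iterate_pred, level_pred] at h1
  rw [triangleCoord_mem_interior hv] at h
  -- The levels sum to 0 and each is at least that of v i, so j is at most n - 2.
  have hs := sum_level z
  rw [Fin.sum_univ_three] at hv
  have h0 := h 0
  have h1' := h 1
  have h2 := h 2
  rw [Finset.mem_range]
  fin_cases i <;> simp at h1 <;> omega

/-- `tetra n v c` as an element of `ℓ²`. -/
noncomputable def tetraLp [NeZero q] (n : ℕ) (v : Fin 3 → TreeVertex q) (c : (Fin 3 → ℤ) → ℂ) :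
    lp (fun _ : DLVertex (fun _ : Fin 3 => q) => ℂ) 2 :=
  restrictLp (tetraSupport n v) (tetra n v c)

theorem tetraLp_apply [NeZero q] (hv : ∑ i, (v i).level = 3 - n) (c : (Fin 3 → ℤ) → ℂ)
    (z : DLVertex (fun _ : Fin 3 => q)) : tetraLp n v c z = tetra n v c z :=
  restrictLp_apply (tetra_eq_zero hv)

theorem srwDL3_tetraLp [NeZero q] (hv : ∑ i, (v i).level = 3 - n) {m : Fin 3 → ℤ}
    (hm : m ∈ triangleInterior n) : srwDL3 q (tetraLp n v (psi m n)) =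
      (eigenvalue m n : ℂ) • tetraLp n v (psi m n) := by
  have hn : n ≠ 0 := by
    rintro rfl
    rw [mem_triangleInterior, Fin.sum_univ_three] at hm
    omega
  have hm0 := (mem_triangleInterior.1 hm).1
  have hq : (q : ℂ) ≠ 0 := Nat.cast_ne_zero.2 (NeZero.ne q)
  ext x
  rw [srwDL3_apply, lp.coeFn_smul, Pi.smul_apply, smul_eq_mul]
  simp only [tetraLp_apply hv]
  have e : ∑ p : {p : Fin 3 × Fin 3 // p.1 ≠ p.2}, ∑ l : ZMod q,
      tetra n v (psi m n) (DL.neighbor x ⟨p, l⟩) = q * ∑ i, ∑ j ∈ Finset.univ.erase i,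
        tetra n v (fun k => psi m n (k + Pi.single i 1 - Pi.single j 1)) x := by
    refine Eq.trans ?_ (congrArg (fun s => (q : ℂ) * s) (sum_ne_pairs (fun i j => tetra n v
      (fun k => psi m n (k + Pi.single j 1 - Pi.single i 1)) x)))
    simp only [Finset.mul_sum]
    exact Finset.sum_congr rfl fun p _ => sum_tetra_neighbor hv
      (fun k hk => psi_eq_zero_of_mem_triangleBoundary hn hm0 hk) x p
  rw [e]
  by_cases hx : triangleCoord v x ∈ triangleInterior n
  · have h := latticeQ_psi n m (sum_triangleCoord v x)
    rw [latticeQ] at h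
    simp only [tetra, if_pos hx, ← Finset.sum_mul]
    -- The factor q from the successors reduces 1/(6q) to the weight 1/6 of the lattice walk.
    rw [← mul_assoc (eigenvalue m n : ℂ), ← h]
    field_simp
  · simp only [tetra, if_neg hx, Finset.sum_const_zero, mul_zero]

end Walk

/-! ### Eigenvalues of the walk -/

/-- The set of the numbers `λ_{m,n}`. -/
def eigenvalueSet : Set ℂ :=
  {z : ℂ | ∃ n : ℕ, 2 ≤ n ∧ ∃ m ∈ triangleInterior n, z = (eigenvalue m n : ℂ)}

theorem three_le_of_mem_triangleInterior {n : ℕ} {m : Fin 3 → ℤ} (hm : m ∈ triangleInterior n) :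
    3 ≤ n := by
  rw [mem_triangleInterior, Fin.sum_univ_three] at hm
  omega

theorem eigenvalue_mem_eigenvalueSet {n : ℕ} {m : Fin 3 → ℤ} (hm : m ∈ triangleInterior n) :
    (eigenvalue m n : ℂ) ∈ eigenvalueSet :=
  ⟨n, by linarith [three_le_of_mem_triangleInterior hm], m, hm, rfl⟩

theorem exists_psi_ne_zero {n : ℕ} {m : Fin 3 → ℤ} (hm : m ∈ triangleInterior n) :
    ∃ k ∈ triangleInterior n, psi m n k ≠ 0 := by
  by_contra! h
  have hn : n ≠ 0 := by linarith [three_le_of_mem_triangleInterior hm]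
  have := sum_psi_mul_conj hn hm hm
  rw [if_pos rfl, sum_triangle_eq _ fun k hk => by
    rw [psi_eq_zero_of_mem_triangleBoundary hn (mem_triangleInterior.1 hm).1 hk, zero_mul],
    Finset.sum_eq_zero fun k hk => by rw [h k hk, zero_mul]] at this
  exact zero_ne_one this

/-- The vertex at level `L` on the geodesic all of whose labels vanish. -/
def zeroVertex (q : ℕ) (L : ℤ) : TreeVertex q := ⟨L, 0, fun _ _ => rfl⟩

theorem below_zeroVertex {q : ℕ} {K L : ℤ} (h : K ≤ L) :
    Below (zeroVertex q K) (zeroVertex q L) := by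
  have hp : ∀ L, (zeroVertex q L).pred = zeroVertex q (L - 1) := fun L => by
    ext i
    · rfl
    · simp [zeroVertex, pred]
  have hj : ∀ (j : ℕ) L, pred^[j] (zeroVertex q L) = zeroVertex q (L - j) := by
    intro j
    induction j with
    | zero => simp
    | succ j ih =>
      intro L
      rw [Function.iterate_succ_apply, hp, ih]
      congr 1
      push_cast
      ring
  refine ⟨(L - K).toNat, ?_⟩
  rw [hj]
  congr 1
  omega

variable {q : ℕ}

theorem hasEigenvalue_srwDL3 [NeZero q] (hq : 2 ≤ q) {n : ℕ} {m : Fin 3 → ℤ}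
    (hm : m ∈ triangleInterior n) :
    Module.End.HasEigenvalue (srwDL3 q).toLinearMap (eigenvalue m n : ℂ) := by
  obtain ⟨k, hk, hk0⟩ := exists_psi_ne_zero hm
  -- With these levels, triangle coordinates coincide with the levels of z.
  let v : Fin 3 → TreeVertex q := ![zeroVertex q 1, zeroVertex q 1, zeroVertex q (1 - n)]
  have hv : ∑ i, (v i).level = 3 - n := by
    simp only [v, Fin.sum_univ_three, Matrix.cons_val, zeroVertex]
    ring
  have hk' := mem_triangleInterior.1 hk
  let z : DLVertex (fun _ : Fin 3 => q) := ⟨fun i => zeroVertex q (k i), hk'.1⟩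
  have hz : triangleCoord v z = k := by
    ext i
    fin_cases i <;> simp [triangleCoord, v, z, zeroVertex]
    ring
  have hb : ∀ i, Below (v i) (z.1 i) := by
    intro i
    fin_cases i
    · exact below_zeroVertex (by simp; omega)
    · exact below_zeroVertex (by simp; omega)
    · exact below_zeroVertex (by simp; omega)
  refine Module.End.hasEigenvalue_of_hasEigenvector (x := tetraLp n v (psi m n)) ⟨?_, ?_⟩
  · exact Module.End.mem_eigenspace_iff.2 (srwDL3_tetraLp hv hm)
  · intro h0
    have h1 : tetraLp n v (psi m n) z = 0 := by rw [h0]; rfl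
    rw [tetraLp_apply hv, tetra, hz, if_pos hk, Finset.prod_congr rfl fun i _ => haar_of_below (hb i),
      Finset.prod_const] at h1
    -- Each `haar` factor at z equals 1 - 1/q, which is nonzero because q ≥ 2.
    have hq' : (1 - 1 / q : ℂ) ≠ 0 := by
      rw [sub_ne_zero, ne_comm, one_div, inv_ne_one]
      exact_mod_cast (by omega : q ≠ 1)
    exact mul_ne_zero hk0 (pow_ne_zero _ hq') h1

theorem tetraLp_mem [NeZero q] {n : ℕ} {v : Fin 3 → TreeVertex q}
    (hv : ∑ i, (v i).level = 3 - n) (c : (Fin 3 → ℤ) → ℂ) :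
    tetraLp n v c ∈ eigenspaceSum (srwDL3 q) eigenvalueSet := by
  -- Only the values of c on the interior matter, and there c is expanded in the orthonormal basis
  -- of the `psi m n`.
  have e : tetraLp n v c = ∑ m ∈ triangleInterior n,
      (∑ k ∈ triangleInterior n, c k * (starRingEnd ℂ) (psi m n k)) • tetraLp n v (psi m n) := by
    ext z
    rw [tetraLp_apply hv, lp.coeFn_sum, Finset.sum_apply]
    simp only [lp.coeFn_smul, Pi.smul_apply, smul_eq_mul, tetraLp_apply hv]
    by_cases hz : triangleCoord v z ∈ triangleInterior n
    · have hn : n ≠ 0 := by linarith [three_le_of_mem_triangleInterior hz]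
      simp only [tetra, if_pos hz, ← mul_assoc]
      rw [← Finset.sum_mul]
      congr 1
      simp only [Finset.sum_mul, mul_assoc]
      rw [Finset.sum_comm]
      simp only [← Finset.mul_sum]
      rw [Finset.sum_congr rfl fun k hk => by rw [sum_conj_psi_mul_psi hn hk hz]]
      simp only [mul_ite, mul_one, mul_zero]
      rw [Finset.sum_ite_eq', if_pos hz]
    · simp [tetra, if_neg hz]
  rw [e]
  refine Submodule.sum_mem _ fun m hm => Submodule.smul_mem _ _ ?_
  exact mem_eigenspaceSum (eigenvalue_mem_eigenvalueSet hm) (srwDL3_tetraLp hv hm)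

/-! ### Approximation of point masses -/

/-- Telescoping puts a k - a (k + j) in W, and these vectors converge to a k as j grows. -/
theorem mem_of_sub_succ_mem {E : Type*} [NormedAddCommGroup E] [NormedSpace ℂ E]
    {W : Submodule ℂ E} (hW : IsClosed (W : Set E)) {a : ℕ → E}
    (h : ∀ k, a k - a (k + 1) ∈ W) (ha : Filter.Tendsto a Filter.atTop (nhds 0)) (k : ℕ) :
    a k ∈ W := by
  have h1 : ∀ j, a k - a (k + j) ∈ W := by
    intro j
    induction j with
    | zero => simp
    | succ j ih =>
      have := W.add_mem ih (h (k + j))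
      rwa [sub_add_sub_cancel, add_assoc] at this
  have h2 : Filter.Tendsto (fun j => a k - a (k + j)) Filter.atTop (nhds (a k - 0)) := by
    refine tendsto_const_nhds.sub (ha.comp ?_)
    exact Filter.tendsto_atTop_mono (fun j => Nat.le_add_left j k) Filter.tendsto_id
  rw [sub_zero] at h2
  exact hW.mem_of_tendsto h2 (Filter.Eventually.of_forall h1)

open Classical in
/-- The normalized indicator function of the vertices on the horocycle of `x` which lie below the
`k`-th ancestor of `x`. -/
noncomputable def avg (x : TreeVertex q) (k : ℕ) (z : TreeVertex q) : ℂ :=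
  if z.level = x.level ∧ pred^[k] z = pred^[k] x then (1 / q) ^ k else 0

/-- On the horocycle of x, sharing the k-th ancestor of x is the same as lying below it, so passing
to a set larger by one generation subtracts exactly the second term of `haar`. -/
theorem avg_sub_avg_succ {x z : TreeVertex q} (h : z.level = x.level) (k : ℕ) :
    avg x k z - avg x (k + 1) z = (1 / q) ^ k * haar (pred^[k] x) z := by
  classical
  have b1 := iterate_pred_eq_iff h k
  have b2 := iterate_pred_eq_iff h (k + 1)
  nth_rewrite 3 [Function.iterate_succ_apply'] at b2
  have a1 : avg x k z = if Below (pred^[k] x) z then (1 / q : ℂ) ^ k else 0 :=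
    if_congr (by rw [b1, and_iff_right h]) rfl rfl
  have a2 : avg x (k + 1) z = if Below (pred^[k] x).pred z then (1 / q : ℂ) ^ (k + 1) else 0 :=
    if_congr (by rw [b2, and_iff_right h]) rfl rfl
  have a3 : haar (pred^[k] x) z = (if Below (pred^[k] x) z then 1 else 0) -
      (1 / q) * (if Below (pred^[k] x).pred z then 1 else 0) := by
    unfold haar
    congr
  rw [a1, a2, a3]
  split_ifs <;> ring

theorem avg_of_level_ne {x z : TreeVertex q} (h : z.level ≠ x.level) (k : ℕ) : avg x k z = 0 := by
  rw [avg, if_neg fun h' => h h'.1]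

/-- The normalized indicator function of a product of horocyclic sets. -/
noncomputable def avgLp [NeZero q] (x : DLVertex (fun _ : Fin 3 => q)) (k : Fin 3 → ℕ) :
    lp (fun _ : DLVertex (fun _ : Fin 3 => q) => ℂ) 2 :=
  restrictLp (dlBox fun i => descendants (k i) (pred^[k i] (x.1 i)))
    (fun z => ∏ i, avg (x.1 i) (k i) (z.1 i))

theorem avgLp_apply [NeZero q] (x : DLVertex (fun _ : Fin 3 => q)) (k : Fin 3 → ℕ)
    (z : DLVertex (fun _ : Fin 3 => q)) :
    avgLp x k z = ∏ i, avg (x.1 i) (k i) (z.1 i) := by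
  have h0 : z ∉ dlBox (fun i => descendants (k i) (pred^[k i] (x.1 i))) →
      ∏ i, avg (x.1 i) (k i) (z.1 i) = 0 := ?_
  · unfold avgLp
    exact restrictLp_apply (f := fun z : DLVertex (fun _ : Fin 3 => q) =>
      ∏ i, avg (x.1 i) (k i) (z.1 i)) h0
  intro hz
  rw [mem_dlBox] at hz
  push Not at hz
  obtain ⟨i, hi⟩ := hz
  refine Finset.prod_eq_zero (Finset.mem_univ i) ?_
  rw [avg, if_neg]
  exact fun h => hi (mem_descendants.2 h.2)

/-- The support has at most ∏ q^(k i) points and each value is at most ∏ q^(-k i), so the squared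
norm is at most ∏ q^(-k i), and discarding two factors only increases it. -/
theorem norm_avgLp_sq_le [NeZero q] (x : DLVertex (fun _ : Fin 3 => q)) (k : Fin 3 → ℕ) (j : Fin 3) :
    ‖avgLp x k‖ ^ 2 ≤ (1 / q : ℝ) ^ k j := by
  have hq : (1 : ℝ) ≤ q := by exact_mod_cast Nat.one_le_iff_ne_zero.2 (NeZero.ne q)
  have hq0 : (q : ℝ) ≠ 0 := by positivity
  have h1 : ∀ z : DLVertex (fun _ : Fin 3 => q),
      ‖∏ i, avg (x.1 i) (k i) (z.1 i)‖ ^ 2 ≤ ∏ i, ((1 / q : ℝ) ^ k i) ^ 2 := by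
    intro z
    rw [norm_prod, ← Finset.prod_pow]
    refine Finset.prod_le_prod (fun i _ => by positivity) fun i _ => ?_
    gcongr
    rw [avg]
    split_ifs
    · simp
    · simp
  rw [avgLp, norm_restrictLp_sq]
  refine (Finset.sum_le_card_nsmul _ _ _ fun z _ => h1 z).trans ?_
  rw [nsmul_eq_mul]
  have h2 : ((dlBox fun i => descendants (k i) (pred^[k i] (x.1 i))).card : ℝ) ≤
      ∏ i, (q : ℝ) ^ k i := by
    have := (card_dlBox_le fun i => descendants (k i) (pred^[k i] (x.1 i))).trans
      (Finset.prod_le_prod' fun i _ => card_descendants_le (k i) (pred^[k i] (x.1 i)))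
    exact_mod_cast this
  calc _ ≤ (∏ i, (q : ℝ) ^ k i) * ∏ i, ((1 / q : ℝ) ^ k i) ^ 2 := by gcongr
    _ = ∏ i, (1 / q : ℝ) ^ k i := by
      rw [← Finset.prod_mul_distrib]
      refine Finset.prod_congr rfl fun i _ => ?_
      rw [pow_two, ← mul_assoc, ← mul_pow, mul_one_div_cancel hq0, one_pow, one_mul]
    _ ≤ (1 / q : ℝ) ^ k j := by
      rw [← Finset.mul_prod_erase _ _ (Finset.mem_univ j)]
      refine mul_le_of_le_one_right (by positivity) (Finset.prod_le_one (fun i _ => by positivity)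
        fun i _ => pow_le_one₀ (by positivity) ?_)
      rw [div_le_one (by positivity)]
      exact hq

theorem tendsto_avgLp [NeZero q] (hq : 2 ≤ q) (x : DLVertex (fun _ : Fin 3 => q))
    (k : ℕ → Fin 3 → ℕ) (j : Fin 3) (hk : ∀ i, k i j = i) :
    Filter.Tendsto (fun i => avgLp x (k i)) Filter.atTop (nhds 0) := by
  rw [tendsto_zero_iff_norm_tendsto_zero]
  have h1 : Filter.Tendsto (fun i : ℕ => (1 / q : ℝ) ^ i) Filter.atTop (nhds 0) := by
    refine tendsto_pow_atTop_nhds_zero_of_lt_one (by positivity) ?_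
    rw [div_lt_one (by positivity)]
    exact_mod_cast hq
  have h2 := squeeze_zero (fun i => by positivity)
    (fun i => (norm_avgLp_sq_le x (k i) j).trans_eq (by rw [hk i])) h1
  have h3 := h2.sqrt
  simpa [Real.sqrt_sq] using h3

/-- The triple difference factors into one-coordinate differences, each a multiple of `haar` at an
ancestor of x. It is thus the product function whose level part is a multiple of the point mass at
the position of x. -/
theorem alternating_sum_avgLp_mem [NeZero q] (x : DLVertex (fun _ : Fin 3 => q)) (a b c : ℕ) :
    (avgLp x ![a, b, c] - avgLp x ![a, b, c + 1] - (avgLp x ![a, b + 1, c] -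
      avgLp x ![a, b + 1, c + 1])) - (avgLp x ![a + 1, b, c] - avgLp x ![a + 1, b, c + 1] -
      (avgLp x ![a + 1, b + 1, c] - avgLp x ![a + 1, b + 1, c + 1])) ∈
      eigenspaceSum (srwDL3 q) eigenvalueSet := by
  let k : Fin 3 → ℕ := ![a, b, c]
  let v : Fin 3 → TreeVertex q := fun i => pred^[k i] (x.1 i)
  have hl : ∀ i, (v i).level = (x.1 i).level - k i := fun i => level_iterate_pred _ _
  -- The levels of the ancestors sum to -(a + b + c), which forces n = 3 + a + b + c.
  have hv : ∑ i, (v i).level = 3 - (3 + a + b + c : ℕ) := by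
    have := sum_level x
    simp only [hl, Fin.sum_univ_three, k, Matrix.cons_val]
    push_cast
    linarith
  classical
  convert tetraLp_mem hv (fun l => if l = triangleCoord v x then ∏ i, (1 / q : ℂ) ^ k i else 0)
    using 1
  ext z
  rw [tetraLp_apply hv]
  have e : (avgLp x ![a, b, c] - avgLp x ![a, b, c + 1] - (avgLp x ![a, b + 1, c] -
      avgLp x ![a, b + 1, c + 1])) z - (avgLp x ![a + 1, b, c] - avgLp x ![a + 1, b, c + 1] -
      (avgLp x ![a + 1, b + 1, c] - avgLp x ![a + 1, b + 1, c + 1])) z =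
      ∏ i, (avg (x.1 i) (k i) (z.1 i) - avg (x.1 i) (k i + 1) (z.1 i)) := by
    simp only [lp.coeFn_sub, Pi.sub_apply, avgLp_apply, Fin.prod_univ_three, Matrix.cons_val, k]
    ring
  rw [lp.coeFn_sub, Pi.sub_apply, e, tetra]
  by_cases hz : ∀ i, (z.1 i).level = (x.1 i).level
  · have hzx : triangleCoord v z = triangleCoord v x := by
      simp only [triangleCoord, hz]
    rw [if_pos, if_pos hzx, ← Finset.prod_mul_distrib]
    · exact Finset.prod_congr rfl fun i _ => avg_sub_avg_succ (hz i) (k i)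
    · rw [triangleCoord_mem_interior hv]
      intro i
      rw [hz, hl]
      omega
  · have hzx : triangleCoord v z ≠ triangleCoord v x := by
      intro h
      apply hz
      have h0 := congrFun h 0
      have h1 := congrFun h 1
      have h2 := congrFun h 2
      simp only [triangleCoord, Matrix.cons_val] at h0 h1 h2
      intro i
      fin_cases i <;> simp <;> omega
    push Not at hz
    obtain ⟨i, hi⟩ := hz
    rw [if_neg hzx, zero_mul, ite_self]
    refine Finset.prod_eq_zero (Finset.mem_univ i) ?_
    rw [avg_of_level_ne hi, avg_of_level_ne hi, sub_zero]

/-- The point mass is the average over one-point sets. The three differences are removed one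
coordinate at a time, each by telescoping to infinity while the other two indices stay fixed. -/
theorem single_mem_closure_eigenspaceSum [NeZero q] (hq : 2 ≤ q)
    [DecidableEq (DLVertex (fun _ : Fin 3 => q))] (x : DLVertex (fun _ : Fin 3 => q)) :
    lp.single 2 x (1 : ℂ) ∈ (eigenspaceSum (srwDL3 q) eigenvalueSet).topologicalClosure := by
  set W := (eigenspaceSum (srwDL3 q) eigenvalueSet).topologicalClosure with hW
  have hcl : IsClosed (W : Set (lp (fun _ : DLVertex (fun _ : Fin 3 => q) => ℂ) 2)) :=
    Submodule.isClosed_topologicalClosure _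
  have h3 : ∀ a b c, avgLp x ![a, b, c] - avgLp x ![a, b, c + 1] - (avgLp x ![a, b + 1, c] -
      avgLp x ![a, b + 1, c + 1]) ∈ W := by
    intro a b c
    refine mem_of_sub_succ_mem hcl (a := fun a => avgLp x ![a, b, c] - avgLp x ![a, b, c + 1] -
      (avgLp x ![a, b + 1, c] - avgLp x ![a, b + 1, c + 1]))
      (fun a => Submodule.le_topologicalClosure _ (alternating_sum_avgLp_mem x a b c)) ?_ a
    have t := fun b c => tendsto_avgLp hq x (fun a => ![a, b, c]) 0 (fun _ => rfl)
    simpa using ((t b c).sub (t b (c + 1))).sub ((t (b + 1) c).sub (t (b + 1) (c + 1)))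
  have h2 : ∀ a b c, avgLp x ![a, b, c] - avgLp x ![a, b, c + 1] ∈ W := by
    intro a b c
    refine mem_of_sub_succ_mem hcl (a := fun b => avgLp x ![a, b, c] - avgLp x ![a, b, c + 1])
      (fun b => h3 a b c) ?_ b
    have t := fun c => tendsto_avgLp hq x (fun b => ![a, b, c]) 1 (fun _ => rfl)
    simpa using (t c).sub (t (c + 1))
  have h1 : ∀ a b c, avgLp x ![a, b, c] ∈ W := fun a b c =>
    mem_of_sub_succ_mem hcl (a := fun c => avgLp x ![a, b, c]) (fun c => h2 a b c)
      (tendsto_avgLp hq x (fun c => ![a, b, c]) 2 (fun _ => rfl)) c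
  convert h1 0 0 0 using 1
  ext z
  rw [avgLp_apply, lp.single_apply, Pi.single_apply]
  split_ifs with h
  · subst h
    symm
    refine Finset.prod_eq_one fun i _ => ?_
    fin_cases i <;> simp [avg]
  · have : ∃ i, z.1 i ≠ x.1 i := by
      by_contra! hh
      exact h (Subtype.ext (funext hh))
    obtain ⟨i, hi⟩ := this
    symm
    refine Finset.prod_eq_zero (Finset.mem_univ i) ?_
    have hk : (![0, 0, 0] : Fin 3 → ℕ) i = 0 := by fin_cases i <;> rfl
    rw [hk, avg, if_neg]
    exact fun h => hi h.2

theorem closure_eigenspaceSum_eq_top [NeZero q] (hq : 2 ≤ q) :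
    (eigenspaceSum (srwDL3 q) eigenvalueSet).topologicalClosure = ⊤ := by
  classical
  rw [eq_top_iff]
  intro f _
  have h := lp.hasSum_single (p := 2) (by norm_num) f
  refine (Submodule.isClosed_topologicalClosure _).mem_of_tendsto h
    (Filter.Eventually.of_forall fun s => Submodule.sum_mem _ fun x _ => ?_)
  have := Submodule.smul_mem _ (f x) (single_mem_closure_eigenspaceSum hq x)
  rwa [← lp.single_smul, smul_eq_mul, mul_one] at this

/-! ### The closure of the set of the `λ_{m,n}` -/

/-- The bound is |1 + exp(ix) + exp(-iy)|² ≥ 0, since the left side is 3 + 2(cos x + cos y + cos(x +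
y)); the two squares supplied are those of its real and imaginary parts. -/
theorem neg_half_le_eigenvalue (m : Fin 3 → ℤ) (n : ℕ) : -1 / 2 ≤ eigenvalue m n := by
  rw [eigenvalue]
  set x := 2 * Real.pi * (m 0 - m 1) / (3 * n) with hx
  set y := 2 * Real.pi * (m 1 - m 2) / (3 * n) with hy
  have hz : 2 * Real.pi * (m 2 - m 0) / (3 * n) = -(x + y) := by
    rw [hx, hy]
    ring
  rw [hz, Real.cos_neg, Real.cos_add]
  nlinarith [sq_nonneg (1 + Real.cos x + Real.cos y), sq_nonneg (Real.sin x - Real.sin y),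
    Real.sin_sq_add_cos_sq x, Real.sin_sq_add_cos_sq y]

theorem eigenvalue_le_one (m : Fin 3 → ℤ) (n : ℕ) : eigenvalue m n ≤ 1 := by
  rw [eigenvalue]
  linarith [Real.cos_le_one (2 * Real.pi * (m 0 - m 1) / (3 * n)),
    Real.cos_le_one (2 * Real.pi * (m 1 - m 2) / (3 * n)),
    Real.cos_le_one (2 * Real.pi * (m 2 - m 0) / (3 * n))]

theorem closure_eigenvalueSet :
    closure eigenvalueSet = Complex.ofReal '' Set.Icc (-1 / 2 : ℝ) 1 := by
  apply Set.Subset.antisymm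
  · refine closure_minimal ?_ (isCompact_Icc.image Complex.continuous_ofReal).isClosed
    rintro _ ⟨n, -, m, -, rfl⟩
    exact ⟨_, ⟨neg_half_le_eigenvalue m n, eigenvalue_le_one m n⟩, rfl⟩
  · rintro _ ⟨t, ht, rfl⟩
    -- on an edge of the triangle the eigenvalue interpolates between `1` and `-1/2`
    let g : ℝ → ℝ → ℝ := fun s ε => 1 / 3 * (Real.cos (2 * Real.pi / 3 * s) +
      Real.cos (2 * Real.pi / 3 * (s + 3 * ε)) + Real.cos (2 * Real.pi / 3 * (-2 * s - 3 * ε)))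
    have hg : Continuous fun p : ℝ × ℝ => g p.1 p.2 := by fun_prop
    have g0 : g 0 0 = 1 := by simp [g]; norm_num
    have g1 : g 1 0 = -1 / 2 := by
      have c1 : Real.cos (2 * Real.pi / 3) = -(1 / 2) := by
        rw [show 2 * Real.pi / 3 = Real.pi - Real.pi / 3 by ring, Real.cos_pi_sub,
          Real.cos_pi_div_three]
      have c2 : Real.cos (2 * Real.pi / 3 * (-2)) = -(1 / 2) := by
        rw [show 2 * Real.pi / 3 * (-2) = -(Real.pi / 3 + Real.pi) by ring, Real.cos_neg,
          Real.cos_add_pi, Real.cos_pi_div_three]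
      simp only [g, mul_zero, add_zero, sub_zero, mul_one, c1, c2]
      norm_num
    obtain ⟨s, hs, hst⟩ : ∃ s ∈ Set.Icc (0 : ℝ) 1, g s 0 = t := by
      have := intermediate_value_Icc' (f := fun s => g s 0) zero_le_one
        (hg.comp (by fun_prop : Continuous fun s : ℝ => (s, (0 : ℝ)))).continuousOn
      simp only [g0, g1] at this
      exact this ht
    let u : ℕ → ℝ := fun N => (⌊s * N⌋₊ : ℝ) / (N + 3)
    have hu : Filter.Tendsto u Filter.atTop (nhds s) := by
      have h1 := (tendsto_nat_floor_mul_div_atTop (R := ℝ) hs.1).comp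
        (tendsto_natCast_atTop_atTop (R := ℝ))
      have h2 := h1.mul (tendsto_natCast_div_add_atTop (𝕜 := ℝ) 3)
      rw [mul_one] at h2
      refine h2.congr' ?_
      filter_upwards [Filter.eventually_gt_atTop 0] with N hN
      have : (N : ℝ) ≠ 0 := by positivity
      simp only [u, Function.comp]
      field_simp
    have hε : Filter.Tendsto (fun N : ℕ => 1 / ((N : ℝ) + 3)) Filter.atTop (nhds 0) := by
      have := (tendsto_one_div_add_atTop_nhds_zero_nat (𝕜 := ℝ)).comp (Filter.tendsto_add_atTop_nat 2)
      refine this.congr fun N => ?_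
      simp only [Function.comp]
      push_cast
      ring
    have hlim := (hg.tendsto (s, 0)).comp (hu.prodMk_nhds hε)
    simp only [hst] at hlim
    refine mem_closure_of_tendsto ((Complex.continuous_ofReal.tendsto t).comp hlim)
      (Filter.Eventually.of_forall fun N => ?_)
    -- An interior point next to the side where the second coordinate is 0. For n = N + 3 its
    -- differences are n u, n(u + 3ε) and n(-2u - 3ε) with ε = 1/n, so λ is exactly g(u, ε) and the
    -- distance from the side is absorbed by ε → 0.
    let m : Fin 3 → ℤ := ![(⌊s * N⌋₊ : ℤ) + 1, 1, -(⌊s * N⌋₊ : ℤ) - 2]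
    have hfl : ⌊s * N⌋₊ ≤ N := by
      refine Nat.floor_le_of_le ?_
      have := hs.2
      nlinarith [(Nat.cast_nonneg N : (0 : ℝ) ≤ N)]
    have hm : m ∈ triangleInterior (N + 3) := by
      rw [mem_triangleInterior, Fin.sum_univ_three]
      simp only [m, Matrix.cons_val]
      omega
    have := eigenvalue_mem_eigenvalueSet hm
    convert this using 1
    have hN : (N : ℝ) + 3 ≠ 0 := by positivity
    refine congrArg Complex.ofReal ?_
    simp only [Function.comp, eigenvalue, g, u, m, Matrix.cons_val]
    push_cast
    refine congrArg _ (congrArg₂ _ (congrArg₂ _ (congrArg _ ?_) (congrArg _ ?_)) (congrArg _ ?_))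
    all_goals
      field_simp
      ring

end DiestelLeader

/-! ### The spectrum and the eigenvalues of the walk -/

theorem corollary5p13 (q : ℕ) [NeZero q] (hq : 2 ≤ q) :
    -- the spectrum is the interval `[-1/2, 1]`
    spectrum ℂ (DiestelLeader.srwDL3 q) = Complex.ofReal '' Set.Icc (-1 / 2 : ℝ) 1 ∧
    -- it is the closure of the set of the `λ_{m,n}`, and these are the eigenvalues
    spectrum ℂ (DiestelLeader.srwDL3 q) =
      closure {z : ℂ | ∃ n : ℕ, 2 ≤ n ∧ ∃ m ∈ DiestelLeader.triangleInterior n,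
        z = (DiestelLeader.eigenvalue m n : ℂ)} ∧
    {z : ℂ | Module.End.HasEigenvalue (DiestelLeader.srwDL3 q).toLinearMap z} =
      {z : ℂ | ∃ n : ℕ, 2 ≤ n ∧ ∃ m ∈ DiestelLeader.triangleInterior n,
        z = (DiestelLeader.eigenvalue m n : ℂ)} ∧
    -- the `ψ_{m,n}` are orthonormal Dirichlet eigenfunctions on `B_n`
    ∀ n : ℕ, 2 ≤ n →
      (∀ m ∈ DiestelLeader.triangleInterior n, ∀ k ∈ DiestelLeader.triangleBoundary n,
        DiestelLeader.psi m n k = 0) ∧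
      (∀ m ∈ DiestelLeader.triangleInterior n, ∀ m' ∈ DiestelLeader.triangleInterior n,
        ∑ k ∈ DiestelLeader.triangle n,
          DiestelLeader.psi m n k * (starRingEnd ℂ) (DiestelLeader.psi m' n k) =
            if m = m' then 1 else 0) ∧
      (∀ m ∈ DiestelLeader.triangleInterior n, ∀ k ∈ DiestelLeader.triangle n,
        DiestelLeader.dirichletQ n (DiestelLeader.psi m n) k =
          (DiestelLeader.eigenvalue m n : ℂ) * DiestelLeader.psi m n k) := by
  have hsym : (DiestelLeader.srwDL3 q).toLinearMap.IsSymmetric :=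
    DiestelLeader.srw_isSymmetric _ (DiestelLeader.DL.isRegularOfDegree (fun _ : Fin 3 => q))
  have htop := DiestelLeader.closure_eigenspaceSum_eq_top hq
  have heig : ∀ z ∈ DiestelLeader.eigenvalueSet,
      Module.End.HasEigenvalue (DiestelLeader.srwDL3 q).toLinearMap z := by
    rintro _ ⟨n, -, m, hm, rfl⟩
    exact DiestelLeader.hasEigenvalue_srwDL3 hq hm
  have hspec := DiestelLeader.spectrum_eq_closure_of_dense hsym htop heig
  refine ⟨hspec.trans DiestelLeader.closure_eigenvalueSet, hspec, ?_, fun n hn => ⟨?_, ?_, ?_⟩⟩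
  · exact Set.Subset.antisymm (fun z => DiestelLeader.eigenvalue_mem_of_dense hsym htop) heig
  · exact fun m hm k hk => DiestelLeader.psi_eq_zero_of_mem_triangleBoundary (by omega)
      (DiestelLeader.mem_triangleInterior.1 hm).1 hk
  · exact fun m hm m' hm' => DiestelLeader.sum_psi_mul_conj (by omega) hm hm'
  · exact fun m hm k hk => DiestelLeader.dirichletQ_psi (by omega)
      (DiestelLeader.mem_triangleInterior.1 hm).1 hk
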